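/- Let $G$ be a separable locally compact (Hausdorff) group and let $S\subset G$ be a compact symmetric generating set containing the identity. All Banach spaces are complex; a representation $(\pi,E)$ of a topological group is a homomorphism $\pi$ into the group of bounded invertible operators of a Banach space $E$ such that $g\mapsto\pi(g)x$ is continuous for every $x\in E$, and $E^\pi$ is the space of invariant vectors. Write $\pi(f)x=\int f(g)\pi(g)x\,dg$ for $f\in C_c(G)$, with $dg$ a left Haar measure. Fix $M>1$ and let $\mathcal R$ be the set of equivalence classes (up to equivariant surjective linear isometries) of representations $(\pi,E)$ of $G$ on separable Banach spaces with $\sup_{g\in S}\|\pi(g)\|\le M$. Give $\mathcal R$ the topology with basis the sets $W_{x_1,\dots,x_n,Q,\varepsilon}(\pi,E)$, where $(\pi,E)\in\mathcal R$, $x_1,\dots,x_n\in E$, $Q\subset G$ is compact and $\varepsilon>0$, consisting of all $(\pi',E')\in\mathcal R$ for which there are $x_1',\dots,x_n'\in E'$ with $$\sup_{f_1,\dots,f_n}\Big|\,\Big\|\sum_k\pi'(f_k)x_k'\Big\|-\Big\|\sum_k\pi(f_k)x_k\Big\|\,\Big|<\varepsilon ,$$ the supremum being over all $f_k\in C_c(G)$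 supported in $Q$ with $\|f_k\|_{L_1}\le1$. For $\mathcal F\subset\mathcal R$ and a quotient $H$ of $G$, let $\mathcal F_{[H]}$ be the set of representations in $\mathcal F$ that factor through $H$, viewed as representations of $H$. For a family $\mathcal F'$ of representations of a locally compact group $H$ that is uniformly bounded on compact sets, $\mathcal C_{\mathcal F'}(H)$ is the completion of the convolution algebra $C_c(H)$ for the norm $\|f\|=\sup_{(\pi,E)\in\mathcal F'}\|\pi(f)\|$. A Kazhdan projection in $\mathcal C_{\mathcal F'}(H)$ is an idempotent $p$ in the closure of $\{f\in C_c(H):\int f=1\}$ such that $\pi(p)$ is a projection onto $E^\pi$ for every $(\pi,E)\in\mathcal F'$. Further, $H^1(H;\pi)$ is the space of continuous cocycles $b\colon H\to E$, $b(gh)=b(g)+\pi(g)b(h)$, modulo those of the form $b(g)=x-\pi(g)x$ with $x\in E$. A locally compact group is compactly presented if it has a compact generating set $T$ and, as an abstract group, a presentation with $T$ as set of generators and relators of bounded length. **Theorem.** Assume that $G$ is compactly presented, that $H=G/N$ for a discrete normal subgroup $N$ of $G$, and that $\mathcal F\subset\mathcal R$ is closed. If $\mathcal C_{\mathcal F_{[H]}}(H)$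 has a Kazhdan projection and $H^1(H;\pi)=0$ for every $(\pi,E)\in\mathcal F_{[H]}$, then there is a normal subgroup $N'$ of $G$ with $N'\subset N$ such that the intermediate quotient $H'=G/N'$ (so $G\to H'\to H$) is compactly presented, $\mathcal C_{\mathcal F_{[H']}}(H')$ has a Kazhdan projection, and $H^1(H';\pi)=0$ for every $(\pi,E)\in\mathcal F_{[H']}$. -/

import Mathlib

open MeasureTheory Topology
open scoped ENNReal CompactlySupported

/-! ### Compact presentation -/

/-- `G` is compactly presented: it has a compact generating set `T` and, as an abstract group, a
presentation with `T` as set of generators and with relators (words in the letters of `T` and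
their inverses) of bounded length. -/
def IsCompactlyPresented (G : Type*) [Group G] [TopologicalSpace G] : Prop :=
  ∃ T : Set G, IsCompact T ∧ Subgroup.closure T = ⊤ ∧
    ∃ (n : ℕ) (R : Set (List (T × Bool))), (∀ w ∈ R, w.length ≤ n) ∧
      (FreeGroup.lift (fun t : T => (t : G))).ker = Subgroup.normalClosure (FreeGroup.mk '' R)

/-! ### Representations on separable Banach spaces -/

/-- A strongly continuous representation of `G` on a separable complex Banach space. A separable
Banach space has at most continuum many points, so every such representation is equivalent
(through an isometry) to one whose space lives in `Type`. The operators are invertible because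
`G` is a group. -/
structure BanachRep (G : Type*) [Group G] [TopologicalSpace G] where
  E : Type
  [normed : NormedAddCommGroup E]
  [space : NormedSpace ℂ E]
  [complete : CompleteSpace E]
  [separable : TopologicalSpace.SeparableSpace E]
  toHom : G →* (E →L[ℂ] E)
  continuous_orbit : ∀ x : E, Continuous fun g => toHom g x

attribute [instance] BanachRep.normed BanachRep.space BanachRep.complete BanachRep.separable

/-- Integration over `G` against (Mathlib's choice of) left Haar measure on the Borel sets. -/
noncomputable def haarIntegral {G : Type*} [Group G] [TopologicalSpace G] [IsTopologicalGroup G]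
    [LocallyCompactSpace G] {E : Type*} [NormedAddCommGroup E] [NormedSpace ℝ E]
    (φ : G → E) : E :=
  letI : MeasurableSpace G := borel G
  haveI : BorelSpace G := ⟨rfl⟩
  ∫ g, φ g ∂Measure.haar

namespace BanachRep

variable {G : Type*} [Group G] [TopologicalSpace G]

/-- The space of invariant vectors. -/
def invariants (ρ : BanachRep G) : Submodule ℂ ρ.E where
  carrier := {x | ∀ g, ρ.toHom g x = x}
  add_mem' := by
    intro x y hx hy g
    rw [map_add, hx g, hy g]
  zero_mem' := fun g => map_zero _
  smul_mem' := by
    intro c x hx g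
    rw [map_smul, hx g]

/-- Continuous cocycles: the translation parts of continuous affine actions with linear
part `ρ`. -/
def Z1 (ρ : BanachRep G) : Submodule ℂ (G → ρ.E) where
  carrier := {b | Continuous b ∧ ∀ g h, b (g * h) = b g + ρ.toHom g (b h)}
  add_mem' := by
    rintro a b ⟨ha, ha'⟩ ⟨hb, hb'⟩
    refine ⟨ha.add hb, fun g h => ?_⟩
    simp only [Pi.add_apply, ha', hb', map_add]
    abel
  zero_mem' := ⟨continuous_const, by simp⟩
  smul_mem' := by
    rintro c b ⟨hb, hb'⟩
    refine ⟨hb.const_smul c, fun g h => ?_⟩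
    simp only [Pi.smul_apply, hb', map_smul, smul_add]

/-- Coboundaries: the functions `g ↦ x - ρ(g) x`. -/
def B1 (ρ : BanachRep G) : Submodule ℂ (G → ρ.E) where
  carrier := {b | ∃ x : ρ.E, ∀ g, b g = x - ρ.toHom g x}
  add_mem' := by
    rintro a b ⟨x, hx⟩ ⟨y, hy⟩
    refine ⟨x + y, fun g => ?_⟩
    simp only [Pi.add_apply, hx, hy, map_add]
    abel
  zero_mem' := ⟨0, by simp⟩
  smul_mem' := by
    rintro c b ⟨x, hx⟩
    refine ⟨c • x, fun g => ?_⟩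
    simp only [Pi.smul_apply, hx, map_smul, smul_sub]

/-- The first cohomology `H¹(G; ρ) = Z¹ / B¹`. -/
abbrev H1 (ρ : BanachRep G) : Type _ := ρ.Z1 ⧸ ρ.B1.submoduleOf ρ.Z1

/-- The representation of `G` defined by a representation of the quotient `G ⧸ N`. -/
def pullback (N : Subgroup G) [N.Normal] (σ : BanachRep (G ⧸ N)) : BanachRep G where
  E := σ.E
  toHom := σ.toHom.comp (QuotientGroup.mk' N)
  continuous_orbit x := (σ.continuous_orbit x).comp continuous_quot_mk

/-- Equivalence: a surjective linear isometry that intertwines the actions. -/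
def Equivalent (ρ ρ' : BanachRep G) : Prop :=
  ∃ u : ρ.E ≃ₗᵢ[ℂ] ρ'.E, ∀ g x, u (ρ.toHom g x) = ρ'.toHom g (u x)

theorem continuous_weighted (ρ : BanachRep G) (f : C_c(G, ℂ)) (x : ρ.E) :
    Continuous fun g => f g • ρ.toHom g x :=
  f.continuous.smul (ρ.continuous_orbit x)

theorem hasCompactSupport_weighted (ρ : BanachRep G) (f : C_c(G, ℂ)) (x : ρ.E) :
    HasCompactSupport fun g => f g • ρ.toHom g x :=
  f.hasCompactSupport.smul_right (f' := fun g => ρ.toHom g x)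

variable [IsTopologicalGroup G] [LocallyCompactSpace G]

theorem exists_bound_weighted (ρ : BanachRep G) (f : C_c(G, ℂ)) :
    ∃ C : ℝ, ∀ x, ‖haarIntegral fun g => f g • ρ.toHom g x‖ ≤ C * ‖x‖ := by
  obtain ⟨C, hC⟩ : ∃ C, ∀ g : tsupport f, ‖ρ.toHom g‖ ≤ C := by
    refine banach_steinhaus fun x => ?_
    obtain ⟨C, hC⟩ := IsCompact.exists_bound_of_continuousOn
      (s := tsupport f) f.hasCompactSupport (ρ.continuous_orbit x).continuousOn
    exact ⟨C, fun g => hC g g.2⟩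
  let _ : MeasurableSpace G := borel G
  have _ : BorelSpace G := ⟨rfl⟩
  refine ⟨(∫ g, ‖f g‖ ∂Measure.haar) * C, fun x => ?_⟩
  have hint : Integrable (fun g => ‖f g‖) (Measure.haar : Measure G) :=
    (f.continuous.integrable_of_hasCompactSupport f.hasCompactSupport).norm
  have h : ‖∫ g, f g • ρ.toHom g x ∂Measure.haar‖ ≤ ∫ g, ‖f g‖ * (C * ‖x‖) ∂Measure.haar := by
    refine norm_integral_le_of_norm_le (hint.mul_const _) (Filter.Eventually.of_forall fun g => ?_)
    by_cases hg : g ∈ tsupport f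
    · rw [norm_smul]
      exact mul_le_mul_of_nonneg_left (((ρ.toHom g).le_opNorm x).trans
        (mul_le_mul_of_nonneg_right (hC ⟨g, hg⟩) (norm_nonneg _))) (norm_nonneg _)
    · simp [image_eq_zero_of_notMem_tsupport hg]
  rw [integral_mul_const, ← mul_assoc] at h
  exact h

/-- The bounded operator `ρ(f) x = ∫ f(g) ρ(g) x dg`, for `f ∈ C_c(G)`. -/
noncomputable def op (ρ : BanachRep G) (f : C_c(G, ℂ)) : ρ.E →L[ℂ] ρ.E :=
  LinearMap.mkContinuousOfExistsBound
    { toFun := fun x => haarIntegral fun g => f g • ρ.toHom g x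
      map_add' := by
        intro x y
        let _ : MeasurableSpace G := borel G
        have _ : BorelSpace G := ⟨rfl⟩
        simp only [map_add, smul_add]
        exact integral_add
          ((ρ.continuous_weighted f x).integrable_of_hasCompactSupport
            (ρ.hasCompactSupport_weighted f x))
          ((ρ.continuous_weighted f y).integrable_of_hasCompactSupport
            (ρ.hasCompactSupport_weighted f y))
      map_smul' := by
        intro c x
        let _ : MeasurableSpace G := borel G
        have _ : BorelSpace G := ⟨rfl⟩
        simp only [map_smul, RingHom.id_apply, smul_comm _ c]
        exact integral_smul c _ }
    (ρ.exists_bound_weighted f)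

theorem op_apply (ρ : BanachRep G) (f : C_c(G, ℂ)) (x : ρ.E) :
    ρ.op f x = haarIntegral fun g => f g • ρ.toHom g x := rfl

end BanachRep

/-! ### The algebra `C_F(G)` and Kazhdan projections -/

section Kazhdan

variable {G : Type*} [Group G] [TopologicalSpace G] [IsTopologicalGroup G]
  [LocallyCompactSpace G]

/-- Families of operators indexed by `F`, multiplied (composed) coordinatewise. -/
abbrev OpFamily (F : Set (BanachRep G)) : Type _ := ∀ ρ : F, ρ.1.E →L[ℂ] ρ.1.E

/-- The (extended) distance on families for the norm `sup_{ρ ∈ F} ‖·‖`. -/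
noncomputable def OpFamily.supDist {F : Set (BanachRep G)} (p q : OpFamily F) : ℝ≥0∞ :=
  ⨆ ρ : F, ‖p ρ - q ρ‖ₑ

/-- The image `(ρ(f))_{ρ ∈ F}` of `f ∈ C_c(G)`. It turns convolution into composition, and the
distance of the images of `f₁` and `f₂` is `‖f₁ - f₂‖_F = sup_{ρ ∈ F} ‖ρ(f₁ - f₂)‖`. -/
noncomputable def OpFamily.ofFun (F : Set (BanachRep G)) (f : C_c(G, ℂ)) : OpFamily F :=
  fun ρ => ρ.1.op f

/-- The closure, for `‖·‖_F`, of a set `A` of functions of `C_c(G)` in the completion `C_F(G)` of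
`C_c(G)`. The map `f ↦ (ρ(f))_{ρ ∈ F}` is isometric for `‖·‖_F` and the space of all families is
complete for uniform convergence, so the completion `C_F(G)` is the uniform closure of the image
of `C_c(G)`; in this model the extension of `ρ ∈ F` to `C_F(G)` is the `ρ`-th coordinate `p ↦ p ρ`,
and the product is the coordinatewise one. -/
def closureInCF (F : Set (BanachRep G)) (A : Set C_c(G, ℂ)) : Set (OpFamily F) :=
  {p | ∀ ε : ℝ≥0∞, 0 < ε → ∃ f ∈ A, OpFamily.supDist p (OpFamily.ofFun F f) < ε}

/-- The Banach algebra `C_F(G)`. -/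
def CF (F : Set (BanachRep G)) : Set (OpFamily F) := closureInCF F Set.univ

/-- `p` is a Kazhdan projection in `C_F(G)`: an idempotent in the closure of
`{f ∈ C_c(G), ∫ f = 1}` such that `ρ(p)` is a projection on `E^ρ` for every `ρ ∈ F`. -/
structure IsKazhdanProjection (F : Set (BanachRep G)) (p : OpFamily F) : Prop where
  mem : p ∈ CF F
  idempotent : IsIdempotentElem p
  mem_closure : p ∈ closureInCF F {f | haarIntegral (fun g => f g) = 1}
  projection : ∀ ρ : F, IsIdempotentElem (p ρ) ∧
    LinearMap.range (p ρ).toLinearMap = ρ.1.invariants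

/-- `C_F(G)` has a Kazhdan projection. -/
def HasKazhdanProjection (F : Set (BanachRep G)) : Prop :=
  ∃ p : OpFamily F, IsKazhdanProjection F p

end Kazhdan

/-! ### The space `R` of representations bounded by `M` on `S`, and its topology -/

/-- The space `R` of representations on separable Banach spaces with `sup_{g ∈ S} ‖ρ(g)‖ ≤ M`.
We work with the representations themselves and not with their equivalence classes: closed
subsets for the topology below are stable under equivalence (`BddRep.mem_of_equivalent`), so they
are the same thing as closed sets of equivalence classes. -/
def BddRep {G : Type*} [Group G] [TopologicalSpace G] (S : Set G) (M : ℝ) : Type _ :=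
  {ρ : BanachRep G // ∀ g ∈ S, ‖ρ.toHom g‖ ≤ M}

namespace BddRep

variable {G : Type*} [Group G] [TopologicalSpace G] {S : Set G} {M : ℝ}

/-- `F_[G ⧸ N]`: the representations in `F` that factor through `G ⧸ N`, seen as representations
of `G ⧸ N`. -/
def factoring (F : Set (BddRep S M)) (N : Subgroup G) [N.Normal] : Set (BanachRep (G ⧸ N)) :=
  {σ | ∃ h : ∀ g ∈ S, ‖(σ.pullback N).toHom g‖ ≤ M, (⟨σ.pullback N, h⟩ : BddRep S M) ∈ F}

variable [IsTopologicalGroup G] [LocallyCompactSpace G]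

/-- The set `W_{x₁,…,xₙ,Q,ε}(ρ)` of all `ρ'` for which there are `x'₁,…,x'ₙ` such that
`sup_{f₁,…,fₙ} |‖∑ ρ'(fₖ) x'ₖ‖ - ‖∑ ρ(fₖ) xₖ‖| < ε`, the supremum being over the `fₖ ∈ C_c(G)`
supported in `Q` with `‖fₖ‖_{L₁} ≤ 1`. -/
def basicNhd (ρ : BddRep S M) {n : ℕ} (x : Fin n → ρ.1.E) (Q : Set G) (ε : ℝ) :
    Set (BddRep S M) :=
  {ρ' | ∃ x' : Fin n → ρ'.1.E, ∃ δ < ε, ∀ f : Fin n → C_c(G, ℂ),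
    (∀ k, tsupport (f k) ⊆ Q ∧ haarIntegral (fun g => ‖f k g‖) ≤ 1) →
      |‖∑ k, ρ'.1.op (f k) (x' k)‖ - ‖∑ k, ρ.1.op (f k) (x k)‖| ≤ δ}

/-- The topology with basis the sets `W_{x₁,…,xₙ,Q,ε}(ρ)`, `Q` compact and `ε > 0`. -/
instance : TopologicalSpace (BddRep S M) :=
  TopologicalSpace.generateFrom
    {U | ∃ (ρ : BddRep S M) (n : ℕ) (x : Fin n → ρ.1.E) (Q : Set G) (ε : ℝ),
      IsCompact Q ∧ 0 < ε ∧ U = basicNhd ρ x Q ε}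

theorem mem_basicNhd_of_equivalent {ρ₁ ρ₂ : BddRep S M} (h : ρ₁.1.Equivalent ρ₂.1)
    (ρ : BddRep S M) {n : ℕ} (x : Fin n → ρ.1.E) (Q : Set G) (ε : ℝ)
    (h₁ : ρ₁ ∈ basicNhd ρ x Q ε) : ρ₂ ∈ basicNhd ρ x Q ε := by
  obtain ⟨u, hu⟩ := h
  obtain ⟨x', δ, hδ, hx'⟩ := h₁
  refine ⟨fun k => u (x' k), δ, hδ, fun f hf => ?_⟩
  have key : ∀ (f : C_c(G, ℂ)) (y : ρ₁.1.E), ρ₂.1.op f (u y) = u (ρ₁.1.op f y) := by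
    intro f y
    let _ : MeasurableSpace G := borel G
    have _ : BorelSpace G := ⟨rfl⟩
    have e : ∀ g, f g • ρ₂.1.toHom g (u y) = u (f g • ρ₁.1.toHom g y) := by
      intro g
      rw [map_smul, hu]
    simp only [BanachRep.op_apply, e]
    exact u.toContinuousLinearEquiv.integral_comp_comm _
  simp only [key, ← map_sum, LinearIsometryEquiv.norm_map]
  exact hx' f hf

theorem mem_of_equivalent {F : Set (BddRep S M)} (hF : IsClosed F) {ρ₁ ρ₂ : BddRep S M}
    (h : ρ₁.1.Equivalent ρ₂.1) (h₁ : ρ₁ ∈ F) : ρ₂ ∈ F := by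
  by_contra h₂
  have hsymm : ρ₂.1.Equivalent ρ₁.1 := by
    obtain ⟨u, hu⟩ := h
    refine ⟨u.symm, fun g x => ?_⟩
    rw [LinearIsometryEquiv.symm_apply_eq, hu, LinearIsometryEquiv.apply_symm_apply]
  have key : ∀ U : Set (BddRep S M), IsOpen U → ρ₂ ∈ U → ρ₁ ∈ U := by
    intro U hU
    induction hU with
    | basic U hU =>
      obtain ⟨ρ, n, x, Q, ε, -, -, rfl⟩ := hU
      exact mem_basicNhd_of_equivalent hsymm ρ x Q ε
    | univ => exact fun _ => trivial
    | inter U V _ _ hU hV => exact fun hm => ⟨hU hm.1, hV hm.2⟩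
    | sUnion 𝒰 _ ih => exact fun ⟨U, hU, hm⟩ => ⟨U, hU, ih U hU hm⟩
  exact key _ hF.isOpen_compl h₂ h₁

end BddRep

/-!
Move the base point of the affine action with linear part `π` and cocycle `b` from `0` to its
average against some `f` with `∫ f = 1`. If one such `f` shrinks the values of the cocycle on a
compact generating set by one factor `κ < 1`, for all representations in a family and all their
cocycles, then the averages against the convolution powers of `f` converge geometrically to a fixed
point of the action. This gives vanishing `H¹` and, applied to coboundaries, a Kazhdan projection.
Conversely, if `p` is a Kazhdan projection and `H¹ = 0`, then every cocycle is the coboundary of a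
vector of `ker π(p)`, and every `f` close enough to `p` shrinks it.

This criterion passes from `G/N` to `G/N'`, where `N'` is the normal closure of `N ∩ S ^ m` for a
large `m`. Otherwise there are, for all `m`, normalized cocycles that are trivial on `N ∩ S ^ m` and
are not contracted. Averaging once against a fixed function makes them equicontinuous, so that they
define a cocycle in an ultraproduct. The representation it spans is trivial on `N` and belongs to
`ℱ`, because `ℱ` is closed, so the cocycle is contracted: a contradiction. Moreover `G/N'` is
compactly presented, because `N'` is the normal closure of a set of elements given by words of
bounded length.
-/

/-! ### Averages over the group -/

section Averages

variable {G : Type*} [Group G] [TopologicalSpace G] [IsTopologicalGroup G]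
  [LocallyCompactSpace G]
variable {E : Type*} [NormedAddCommGroup E] [NormedSpace ℂ E]
variable {E' : Type*} [NormedAddCommGroup E'] [NormedSpace ℂ E']

/-- The average `∫ f(g) ψ(g) dg` of a vector valued function `ψ` against `f ∈ C_c(G)`. -/
noncomputable def haarAverage (f : C_c(G, ℂ)) (ψ : G → E) : E :=
  haarIntegral fun g => f g • ψ g

/-- The `L¹` norm of `f ∈ C_c(G)` for Haar measure. -/
noncomputable def l1Norm (f : C_c(G, ℂ)) : ℝ := haarIntegral fun g => ‖f g‖

theorem BanachRep.op_eq_haarAverage (ρ : BanachRep G) (f : C_c(G, ℂ)) (x : ρ.E) :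
    ρ.op f x = haarAverage f fun g => ρ.toHom g x := rfl

theorem haarAverage_one (f : C_c(G, ℂ)) : haarAverage f (fun _ => (1 : ℂ)) = haarIntegral f := by
  simp only [haarAverage, smul_eq_mul, mul_one]

theorem integrable_smul_haar [MeasurableSpace G] [BorelSpace G] (f : C_c(G, ℂ)) {ψ : G → E}
    (hψ : Continuous ψ) : Integrable (fun g => f g • ψ g) (Measure.haar : Measure G) :=
  (f.continuous.smul hψ).integrable_of_hasCompactSupport
    (f.hasCompactSupport.smul_right (f' := ψ))

theorem haarAverage_sub (f : C_c(G, ℂ)) {ψ χ : G → E} (hψ : Continuous ψ) (hχ : Continuous χ) :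
    haarAverage f (fun g => ψ g - χ g) = haarAverage f ψ - haarAverage f χ := by
  borelize G
  simp only [haarAverage, smul_sub]
  exact integral_sub (integrable_smul_haar f hψ) (integrable_smul_haar f hχ)

theorem haarAverage_add (f : C_c(G, ℂ)) {ψ χ : G → E} (hψ : Continuous ψ) (hχ : Continuous χ) :
    haarAverage f (fun g => ψ g + χ g) = haarAverage f ψ + haarAverage f χ := by
  borelize G
  simp only [haarAverage, smul_add]
  exact integral_add (integrable_smul_haar f hψ) (integrable_smul_haar f hχ)

theorem haarAverage_map [CompleteSpace E] [CompleteSpace E'] (f : C_c(G, ℂ)) (L : E →L[ℂ] E')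
    {ψ : G → E} (hψ : Continuous ψ) :
    haarAverage f (fun g => L (ψ g)) = L (haarAverage f ψ) := by
  borelize G
  simp only [haarAverage, ← map_smul]
  exact L.integral_comp_comm (integrable_smul_haar f hψ)

theorem haarAverage_const [CompleteSpace E] (f : C_c(G, ℂ)) (x : E) :
    haarAverage f (fun _ => x) = haarIntegral f • x := by
  borelize G
  exact integral_smul_const _ _

theorem norm_haarAverage_le (f : C_c(G, ℂ)) {ψ : G → E} {C : ℝ}
    (hC : ∀ g ∈ tsupport f, ‖ψ g‖ ≤ C) : ‖haarAverage f ψ‖ ≤ l1Norm f * C := by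
  borelize G
  calc ‖∫ g, f g • ψ g ∂Measure.haar‖ ≤ ∫ g, ‖f g‖ * C ∂Measure.haar := by
        refine norm_integral_le_of_norm_le (f.integrable.norm.mul_const _) (.of_forall fun g => ?_)
        by_cases hg : g ∈ tsupport f
        · rw [norm_smul]
          exact mul_le_mul_of_nonneg_left (hC g hg) (norm_nonneg _)
        · simp only [image_eq_zero_of_notMem_tsupport hg, zero_smul, norm_zero, zero_mul, le_refl]
    _ = l1Norm f * C := integral_mul_const _ _

theorem exists_isCompact_haarAverage_mem [CompleteSpace E] {ψ : G → E} (hψ : Continuous ψ)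
    {Q : Set G} (hQ : IsCompact Q) : ∃ K, IsCompact K ∧
      ∀ f : C_c(G, ℂ), tsupport f ⊆ Q → l1Norm f ≤ 1 → haarAverage f ψ ∈ K := by
  let s : Set E := insert 0 ((fun p : ℂ × G => p.1 • ψ p.2) '' Metric.closedBall 0 1 ×ˢ Q)
  have hs : IsCompact s :=
    (((isCompact_closedBall 0 1).prod hQ).image (by fun_prop)).insert 0
  refine ⟨closure (convexHull ℝ s),
    hs.totallyBounded.convexHull.closure.isCompact_of_isClosed isClosed_closure, fun f hf hf' => ?_⟩
  have hs_subset : s ⊆ closure (convexHull ℝ s) := (subset_convexHull ℝ s).trans subset_closure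
  by_contra h
  obtain ⟨ℓ, u, hu, hu_lt⟩ :=
    geometric_hahn_banach_closed_point (convex_convexHull ℝ s).closure isClosed_closure h
  have hu_pos : 0 < u := by simpa only [map_zero] using hu 0 (hs_subset (Set.mem_insert _ _))
  have h_le : ∀ g, ℓ (f g • ψ g) ≤ ‖f g‖ * u := fun g => by
    by_cases hg : f g = 0
    · simp only [hg, zero_smul, map_zero, norm_zero, zero_mul, le_refl]
    · have hmem : (‖f g‖⁻¹ : ℂ) • f g • ψ g ∈ s := .inr ⟨((‖f g‖⁻¹ : ℂ) * f g, g), ⟨by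
        simp [hg], hf (subset_tsupport _ hg)⟩, by rw [smul_smul]⟩
      have := hu _ (hs_subset hmem)
      rw [← Complex.ofReal_inv, Complex.coe_smul, map_smul, smul_eq_mul,
        inv_mul_lt_iff₀ (norm_pos_iff.2 hg)] at this
      exact this.le
  borelize G
  refine hu_lt.not_ge ?_
  calc ℓ (haarAverage f ψ) = ∫ g, ℓ (f g • ψ g) ∂Measure.haar :=
        (ℓ.integral_comp_comm (integrable_smul_haar f hψ)).symm
    _ ≤ ∫ g, ‖f g‖ * u ∂Measure.haar := integral_mono
        (ℓ.integrable_comp (integrable_smul_haar f hψ)) (f.integrable.norm.mul_const _) h_le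
    _ = l1Norm f * u := integral_mul_const _ _
    _ ≤ u := mul_le_of_le_one_left hu_pos.le hf'
theorem haarAverage_sub_left (f k : C_c(G, ℂ)) {ψ : G → E} (hψ : Continuous ψ) :
    haarAverage (f - k) ψ = haarAverage f ψ - haarAverage k ψ := by
  borelize G
  simp only [haarAverage, CompactlySupportedContinuousMap.sub_apply, sub_smul]
  exact integral_sub (integrable_smul_haar f hψ) (integrable_smul_haar k hψ)

theorem haarAverage_smul_left (c : ℝ) (f : C_c(G, ℂ)) (ψ : G → E) :
    haarAverage (c • f) ψ = c • haarAverage f ψ := by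
  borelize G
  simp only [haarAverage, CompactlySupportedContinuousMap.smul_apply, smul_assoc]
  exact integral_smul c _

theorem exists_haarIntegral_eq_one : ∃ f : C_c(G, ℂ), haarIntegral f = 1 := by
  borelize G
  obtain ⟨f, hf, hf_nonneg, hf_one⟩ := exists_continuous_nonneg_pos (1 : G)
  have hpos : 0 < ∫ g, f g ∂(Measure.haar : Measure G) :=
    f.continuous.integral_pos_of_hasCompactSupport_nonneg_nonzero hf hf_nonneg hf_one
  set I : ℝ := ∫ g, f g ∂(Measure.haar : Measure G)
  refine ⟨⟨⟨fun g => (I : ℂ)⁻¹ * (f g : ℂ), by fun_prop⟩,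
    (hf.comp_left (g := fun x : ℝ => (x : ℂ)) Complex.ofReal_zero).mul_left⟩, ?_⟩
  change ∫ g, (I : ℂ)⁻¹ * (f g : ℂ) ∂Measure.haar = 1
  rw [integral_const_mul, integral_complex_ofReal]
  exact inv_mul_cancel₀ (by exact_mod_cast hpos.ne')

/-- The left translate `h ↦ f (g⁻¹ h)` of `f`. -/
noncomputable def leftTranslate {G : Type*} [Group G] [TopologicalSpace G] [IsTopologicalGroup G]
    (g : G) (f : C_c(G, ℂ)) : C_c(G, ℂ) :=
  f.comp (Homeomorph.mulLeft g⁻¹).toCocompactMap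

theorem leftTranslate_apply {G : Type*} [Group G] [TopologicalSpace G] [IsTopologicalGroup G]
    (g : G) (f : C_c(G, ℂ)) (h : G) : leftTranslate g f h = f (g⁻¹ * h) := rfl

theorem haarAverage_leftTranslate (g : G) (f : C_c(G, ℂ)) (ψ : G → E) :
    haarAverage (leftTranslate g f) ψ = haarAverage f fun h => ψ (g * h) := by
  borelize G
  have h := integral_mul_left_eq_self (μ := (Measure.haar : Measure G))
    (fun h => f (g⁻¹ * h) • ψ h) g
  simp only [inv_mul_cancel_left] at h
  exact h.symm

theorem continuousOn_l1Norm_leftTranslate_sub {K L : Set G} (hL : IsCompact L) (φ : C_c(G, ℂ))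
    {g₀ : G} (hg₀ : g₀ ∈ K) (hφ : ∀ g ∈ K, ∀ h ∉ L, φ (g⁻¹ * h) = 0) :
    ContinuousOn (fun g => l1Norm (leftTranslate g φ - leftTranslate g₀ φ)) K := by
  borelize G
  refine continuousOn_integral_of_compact_support
    (f := fun g h => ‖φ (g⁻¹ * h) - φ (g₀⁻¹ * h)‖) hL ?_ fun g h hg hh => ?_
  · refine Continuous.continuousOn ?_
    simp only [Function.uncurry_def]
    fun_prop
  · rw [hφ g hg h hh, hφ g₀ hg₀ h hh, sub_zero, norm_zero]

end Averages

section Convolution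

variable {G : Type*} [Group G] [TopologicalSpace G] [IsTopologicalGroup G]
  [LocallyCompactSpace G]
variable {E : Type*} [NormedAddCommGroup E] [NormedSpace ℂ E]

open scoped Pointwise in
theorem smul_inv_mul_eq_zero_of_notMem {G : Type*} [Group G] [TopologicalSpace G]
    {f k : C_c(G, ℂ)} {g h : G}
    (hg : (g, h) ∉ (tsupport f * tsupport k) ×ˢ tsupport f) : f h • k (h⁻¹ * g) = 0 := by
  by_cases hf : h ∈ tsupport f
  · have hk : h⁻¹ * g ∉ tsupport k := fun hk =>
      hg ⟨⟨h, hf, h⁻¹ * g, hk, mul_inv_cancel_left h g⟩, hf⟩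
    rw [image_eq_zero_of_notMem_tsupport hk, smul_zero]
  · rw [image_eq_zero_of_notMem_tsupport hf, zero_smul]

/-- The convolution `(f * k)(g) = ∫ f(h) k(h⁻¹ g) dh` on `C_c(G)`. -/
noncomputable def convolve (f k : C_c(G, ℂ)) : C_c(G, ℂ) where
  toFun g := haarAverage f fun h => k (h⁻¹ * g)
  continuous_toFun := by
    borelize G
    rw [← continuousOn_univ]
    refine continuousOn_integral_of_compact_support (f := fun g h => f h • k (h⁻¹ * g))
      f.hasCompactSupport.isCompact ?_
      fun g h _ hh => smul_inv_mul_eq_zero_of_notMem fun hgh => hh hgh.2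
    refine Continuous.continuousOn ?_
    simp only [Function.uncurry_def]
    fun_prop
  hasCompactSupport' := by
    refine HasCompactSupport.intro
      (f.hasCompactSupport.isCompact.mul k.hasCompactSupport.isCompact) fun g hg => ?_
    borelize G
    have hzero : ∀ h, f h • k (h⁻¹ * g) = 0 := fun h =>
      smul_inv_mul_eq_zero_of_notMem fun hgh => hg hgh.1
    simp only [haarAverage, hzero]
    exact integral_zero _ _

theorem haarAverage_convolve [CompleteSpace E] (f k : C_c(G, ℂ)) {ψ : G → E}
    (hψ : Continuous ψ) :
    haarAverage (convolve f k) ψ = haarAverage f fun h => haarAverage k fun g => ψ (h * g) := by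
  borelize G
  have h_outer : ∀ g, convolve f k g • ψ g =
      ∫ h, (f h • k (h⁻¹ * g)) • ψ g ∂Measure.haar := fun g =>
    (integral_smul_const (μ := (Measure.haar : Measure G))
      (fun h => f h • k (h⁻¹ * g)) (ψ g)).symm
  have h_inner : ∀ h, f h • haarAverage k (fun g => ψ (h * g)) =
      ∫ g, (f h • k (h⁻¹ * g)) • ψ g ∂Measure.haar := by
    intro h
    rw [← haarAverage_leftTranslate]
    simp only [smul_assoc]
    exact (integral_smul (μ := (Measure.haar : Measure G)) (f h)
      (fun g => k (h⁻¹ * g) • ψ g)).symm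
  change ∫ g, convolve f k g • ψ g ∂Measure.haar =
    ∫ h, f h • haarAverage k (fun g => ψ (h * g)) ∂Measure.haar
  simp only [h_outer, h_inner]
  refine integral_integral_swap_of_hasCompactSupport
    (f := fun g h => (f h • k (h⁻¹ * g)) • ψ g) ?_ ?_
  · simp only [Function.uncurry_def]
    fun_prop
  · refine HasCompactSupport.intro
      ((f.hasCompactSupport.isCompact.mul k.hasCompactSupport.isCompact).prod
        f.hasCompactSupport.isCompact) ?_
    rintro ⟨g, h⟩ hgh
    exact (congrArg (· • ψ g) (smul_inv_mul_eq_zero_of_notMem hgh)).trans (zero_smul ℂ _)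

theorem haarIntegral_convolve (f k : C_c(G, ℂ)) :
    haarIntegral (convolve f k) = haarIntegral f * haarIntegral k := by
  rw [← haarAverage_one, haarAverage_convolve f k continuous_const, haarAverage_const,
    haarAverage_one, smul_eq_mul]

end Convolution

/-! ### Averages over a quotient -/

section Quotient

variable {A B C : Type*} [Group A] [Group B] [Group C] [TopologicalSpace A]
  [TopologicalSpace B] [TopologicalSpace C] [IsTopologicalGroup A] [IsTopologicalGroup B]
  [IsTopologicalGroup C] [LocallyCompactSpace B] {φ : A →* B} {π : B →* C}
  [MeasurableSpace A] [BorelSpace A] (μA : Measure A) [μA.IsHaarMeasure]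

theorem pushforward_compLeft_apply {E : Type*} [NormedAddCommGroup E] [NormedSpace ℝ E]
    [CompleteSpace E] (H : TopologicalGroup.IsSES φ π) (ℓ : E →L[ℝ] ℝ) (v : C_c(B, E)) (c : C) :
    H.pushforward μA (v.compLeft ⟨ℓ, ℓ.continuous⟩) c = ℓ (H.pushforward μA v c) := by
  obtain ⟨b, rfl⟩ := H.isOpenQuotientMap.surjective c
  rw [H.pushforward_apply_apply, H.pushforward_apply_apply,
    ← ℓ.integral_comp_comm (H.pullback v b).integrable]
  simp only [TopologicalGroup.IsSES.pullback_def, map_zero, ContinuousMap.coe_mk,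
    CompactlySupportedContinuousMap.compLeft_apply]

theorem exists_integral_eq_smul_integral_pushforward [T2Space B] [MeasurableSpace B]
    [BorelSpace B] (μB : Measure B) [μB.IsHaarMeasure] [MeasurableSpace C] [BorelSpace C]
    (μC : Measure C) [μC.IsHaarMeasure] (H : TopologicalGroup.IsSES φ π) :
    ∃ c : ℝ, ∀ (E : Type) [NormedAddCommGroup E] [NormedSpace ℝ E] [CompleteSpace E]
      (v : C_c(B, E)), ∫ b, v b ∂μB = c • ∫ x, H.pushforward μA v x ∂μC := by
  obtain ⟨c, hc⟩ := Measure.exists_integral_isMulLeftInvariant_eq_smul_of_hasCompactSupport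
    μB (H.inducedMeasure μA μC)
  have h_real : ∀ u : C_c(B, ℝ), ∫ b, u b ∂μB = c * ∫ x, H.pushforward μA u x ∂μC := by
    intro u
    rw [hc u u.continuous u.hasCompactSupport, integral_smul_nnreal_measure,
      H.integral_inducedMeasure, H.integrate_apply]
    rfl
  refine ⟨c, fun E _ _ _ v => (SeparatingDual.eq_iff_forall_dual_eq (R := ℝ)).2 fun ℓ => ?_⟩
  have hv := h_real (v.compLeft ⟨ℓ, ℓ.continuous⟩)
  simp only [pushforward_compLeft_apply] at hv
  rw [map_smul, ← ℓ.integral_comp_comm v.integrable,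
    ← ℓ.integral_comp_comm (H.pushforward μA v).integrable, smul_eq_mul, ← hv]
  simp only [CompactlySupportedContinuousMap.compLeft_apply, map_zero, ContinuousMap.coe_mk]

/-- The function `b ↦ v(b) ψ(π b)`, for `v ∈ C_c(B)` and a continuous function `ψ` on the
quotient. -/
def smulComp {𝕜 E : Type*} [RCLike 𝕜] [NormedAddCommGroup E] [NormedSpace 𝕜 E]
    (H : TopologicalGroup.IsSES φ π) (v : C_c(B, 𝕜)) (ψ : C(C, E)) : C_c(B, E) where
  toFun b := v b • ψ (π b)
  continuous_toFun := v.continuous.smul (ψ.continuous.comp H.isOpenQuotientMap.continuous)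
  hasCompactSupport' := v.hasCompactSupport.smul_right

theorem pushforward_smulComp {𝕜 E : Type*} [RCLike 𝕜] [NormedAddCommGroup E] [NormedSpace ℝ E]
    [NormedSpace 𝕜 E] [CompleteSpace E] (H : TopologicalGroup.IsSES φ π) (v : C_c(B, 𝕜))
    (ψ : C(C, E)) (c : C) :
    H.pushforward μA (smulComp H v ψ) c = H.pushforward μA v c • ψ c := by
  obtain ⟨b, rfl⟩ := H.isOpenQuotientMap.surjective c
  have hπ : ∀ a, π (φ a) = 1 := H.mulExact.apply_apply_eq_one
  rw [H.pushforward_apply_apply, H.pushforward_apply_apply, ← integral_smul_const]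
  simp only [TopologicalGroup.IsSES.pullback_def, smulComp,
    CompactlySupportedContinuousMap.coe_mk, ContinuousMap.coe_mk, map_mul, hπ, mul_one]

theorem pushforward_nonneg (H : TopologicalGroup.IsSES φ π) {e : C_c(B, ℝ)} (he : 0 ≤ e) :
    0 ≤ H.pushforward μA e := by
  simpa only [map_zero] using H.pushforward_mono μA he

theorem exists_pushforward_pos (H : TopologicalGroup.IsSES φ π) {K : Set C} (hK : IsCompact K) :
    ∃ e : C_c(B, ℝ), 0 ≤ e ∧ ∀ x ∈ K, 0 < H.pushforward μA e x := by
  refine hK.induction_on ⟨0, le_rfl, fun x hx => hx.elim⟩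
    (fun s t hst ⟨e, he, hpos⟩ => ⟨e, he, fun x hx => hpos x (hst hx)⟩) ?_ fun x _ => ?_
  · rintro s t ⟨d, hd, hs⟩ ⟨e, he, ht⟩
    refine ⟨d + e, add_nonneg hd he, fun x hx => ?_⟩
    rw [map_add]
    exact hx.elim (fun hx => add_pos_of_pos_of_nonneg (hs x hx) (pushforward_nonneg μA H he x))
      fun hx => add_pos_of_nonneg_of_pos (pushforward_nonneg μA H hd x) (ht x hx)
  · obtain ⟨b, rfl⟩ := H.isOpenQuotientMap.surjective x
    obtain ⟨e, he_supp, he, heb⟩ := exists_continuous_nonneg_pos b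
    let e' : C_c(B, ℝ) := ⟨e, he_supp⟩
    have hpos : 0 < H.pushforward μA e' (π b) := by
      rw [H.pushforward_apply_apply]
      refine (H.pullback e' b).continuous.integral_pos_of_hasCompactSupport_nonneg_nonzero
        (H.pullback e' b).hasCompactSupport (fun a => he _) (x := 1) ?_
      rw [TopologicalGroup.IsSES.pullback_def, map_one, mul_one]
      exact heb
    exact ⟨_, mem_nhdsWithin_of_mem_nhds
      ((H.pushforward μA e').continuous.continuousAt.eventually (lt_mem_nhds hpos)),
      e', he, fun x hx => hx⟩

theorem pushforward_surjective (H : TopologicalGroup.IsSES φ π) :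
    Function.Surjective (H.pushforward μA : C_c(B, ℂ) → C_c(C, ℂ)) := by
  intro f
  obtain ⟨e, -, he⟩ := exists_pushforward_pos μA H f.hasCompactSupport
  let ψ : C(C, ℂ) := ⟨fun x => f x / H.pushforward μA e x, by
    refine continuous_iff_continuousAt.2 fun x => ?_
    by_cases hx : x ∈ tsupport f
    · exact f.continuous.continuousAt.div
        (Complex.continuous_ofReal.comp (H.pushforward μA e).continuous).continuousAt
        (Complex.ofReal_ne_zero.2 (he x hx).ne')
    · refine continuousAt_const.congr (f := fun _ => 0) ?_
      filter_upwards [(isClosed_tsupport f).isOpen_compl.mem_nhds hx] with y hy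
      rw [image_eq_zero_of_notMem_tsupport hy, zero_div]⟩
  refine ⟨smulComp H e ψ, ?_⟩
  ext x
  rw [pushforward_smulComp, Complex.real_smul]
  by_cases hx : x ∈ tsupport f
  · exact mul_div_cancel₀ (f x) (Complex.ofReal_ne_zero.2 (he x hx).ne')
  · simp only [ψ, ContinuousMap.coe_mk, image_eq_zero_of_notMem_tsupport hx, zero_div, mul_zero]

section ClosedSubgroup

variable {G : Type*} [Group G] [TopologicalSpace G] [IsTopologicalGroup G]
  [LocallyCompactSpace G] [T2Space G] (N : Subgroup G) [N.Normal]

theorem exists_haarAverage_pushforward [MeasurableSpace N] [BorelSpace N]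
    (μN : Measure N) [μN.IsHaarMeasure]
    (H : TopologicalGroup.IsSES N.subtype (QuotientGroup.mk' N)) :
    ∃ c : ℝ, ∀ (E : Type) [NormedAddCommGroup E] [NormedSpace ℂ E] [CompleteSpace E]
      (f : C_c(G, ℂ)) (ψ : G ⧸ N → E), Continuous ψ →
        haarAverage f (fun g => ψ g) = c • haarAverage (H.pushforward μN f) ψ := by
  borelize G (G ⧸ N)
  obtain ⟨c, hc⟩ := exists_integral_eq_smul_integral_pushforward μN
    (Measure.haar : Measure G) (Measure.haar : Measure (G ⧸ N)) H
  refine ⟨c, fun E _ _ _ f ψ hψ => (hc E (smulComp H f ⟨ψ, hψ⟩)).trans ?_⟩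
  simp only [pushforward_smulComp]
  rfl

theorem exists_haarAverage_quotient (hN : IsClosed (N : Set G)) (f : C_c(G, ℂ)) :
    ∃ k : C_c(G ⧸ N, ℂ), ∀ (E : Type) [NormedAddCommGroup E] [NormedSpace ℂ E]
      [CompleteSpace E] (ψ : G ⧸ N → E), Continuous ψ →
        haarAverage k ψ = haarAverage f fun g => ψ g := by
  have : LocallyCompactSpace N := hN.isClosedEmbedding_subtypeVal.locallyCompactSpace
  let _ : MeasurableSpace N := borel N
  have _ : BorelSpace N := ⟨rfl⟩
  have H := TopologicalGroup.IsSES.ofClosedSubgroup N hN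
  obtain ⟨c, hc⟩ := exists_haarAverage_pushforward N (Measure.haar : Measure N) H
  exact ⟨c • H.pushforward Measure.haar f, fun E _ _ _ ψ hψ =>
    (haarAverage_smul_left _ _ _).trans (hc E f ψ hψ).symm⟩

theorem exists_haarAverage_lift (hN : IsClosed (N : Set G)) (f : C_c(G ⧸ N, ℂ)) :
    ∃ k : C_c(G, ℂ), ∀ (E : Type) [NormedAddCommGroup E] [NormedSpace ℂ E]
      [CompleteSpace E] (ψ : G ⧸ N → E), Continuous ψ →
        haarAverage k (fun g => ψ g) = haarAverage f ψ := by
  have : LocallyCompactSpace N := hN.isClosedEmbedding_subtypeVal.locallyCompactSpace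
  let _ : MeasurableSpace N := borel N
  have _ : BorelSpace N := ⟨rfl⟩
  have H := TopologicalGroup.IsSES.ofClosedSubgroup N hN
  obtain ⟨c, hc⟩ := exists_haarAverage_pushforward N (Measure.haar : Measure N) H
  have hc0 : c ≠ 0 := by
    rintro rfl
    obtain ⟨u, hu⟩ := exists_haarIntegral_eq_one (G := G)
    have h := hc ℂ u (fun _ => 1) continuous_const
    rw [haarAverage_one, hu, zero_smul] at h
    exact one_ne_zero h
  obtain ⟨v, hv⟩ := pushforward_surjective Measure.haar H f
  refine ⟨c⁻¹ • v, fun E _ _ _ ψ hψ => ?_⟩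
  rw [haarAverage_smul_left, hc E v ψ hψ, hv, inv_smul_smul₀ hc0]

end ClosedSubgroup

end Quotient

/-! ### Compact generating sets -/

/-- `S` is a compact symmetric generating set of `G` that contains the identity. -/
structure IsSymmCompactGenSet {G : Type*} [Group G] [TopologicalSpace G] (S : Set G) : Prop where
  isCompact : IsCompact S
  inv_mem : ∀ g ∈ S, g⁻¹ ∈ S
  one_mem : (1 : G) ∈ S
  closure_eq_top : Subgroup.closure S = ⊤

namespace IsSymmCompactGenSet

open scoped Pointwise

variable {G : Type*} [Group G] [TopologicalSpace G] {S : Set G}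

theorem exists_mem_pow (hS : IsSymmCompactGenSet S) (g : G) : ∃ m : ℕ, g ∈ S ^ m := by
  have hinv : S⁻¹ ⊆ S := fun g hg => inv_inv g ▸ hS.inv_mem _ hg
  have hg : g ∈ Subgroup.closure S := hS.closure_eq_top ▸ Subgroup.mem_top g
  induction hg using Subgroup.closure_induction with
  | mem x hx => exact ⟨1, (pow_one S).symm ▸ hx⟩
  | one => exact ⟨0, Set.mem_one.2 rfl⟩
  | mul x y _ _ hx hy =>
    obtain ⟨m, hm⟩ := hx
    obtain ⟨k, hk⟩ := hy
    exact ⟨m + k, pow_add S m k ▸ Set.mul_mem_mul hm hk⟩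
  | inv x _ hx =>
    obtain ⟨m, hm⟩ := hx
    exact ⟨m, Set.pow_subset_pow_left hinv (inv_pow S m ▸ Set.inv_mem_inv.2 hm)⟩

theorem isCompact_pow [ContinuousMul G] (hS : IsSymmCompactGenSet S) (m : ℕ) :
    IsCompact (S ^ m) := by
  induction m with
  | zero => exact isCompact_singleton
  | succ m ih => exact pow_succ S m ▸ ih.mul hS.isCompact

theorem pow_mono (hS : IsSymmCompactGenSet S) : Monotone (S ^ · : ℕ → Set G) :=
  fun _ _ h => Set.pow_subset_pow_right hS.one_mem h

theorem sigmaCompactSpace [ContinuousMul G] (hS : IsSymmCompactGenSet S) : SigmaCompactSpace G :=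
  SigmaCompactSpace_iff_exists_compact_covering.2
    ⟨_, hS.isCompact_pow, Set.eq_univ_of_forall fun g => Set.mem_iUnion.2 (hS.exists_mem_pow g)⟩

theorem exists_subset_pow [IsTopologicalGroup G] [LocallyCompactSpace G] [T2Space G]
    (hS : IsSymmCompactGenSet S) {K : Set G} (hK : IsCompact K) : ∃ m : ℕ, K ⊆ S ^ m := by
  obtain ⟨m₀, g₀, hg₀⟩ := nonempty_interior_of_iUnion_of_closed
    (fun m => (hS.isCompact_pow m).isClosed)
    (Set.eq_univ_of_forall fun g => Set.mem_iUnion.2 (hS.exists_mem_pow g))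
  refine hK.induction_on ⟨0, Set.empty_subset _⟩ (fun s t hst ⟨m, hm⟩ => ⟨m, hst.trans hm⟩)
    ?_ fun x _ => ?_
  · rintro s t ⟨m, hm⟩ ⟨k, hk⟩
    exact ⟨max m k, Set.union_subset (hm.trans (hS.pow_mono (le_max_left m k)))
      (hk.trans (hS.pow_mono (le_max_right m k)))⟩
  · obtain ⟨m, hm⟩ := hS.exists_mem_pow (x * g₀⁻¹)
    refine ⟨(x * g₀⁻¹) • interior (S ^ m₀), mem_nhdsWithin_of_mem_nhds ?_, m + m₀, ?_⟩
    · exact (isOpen_interior.smul _).mem_nhds ⟨g₀, hg₀, inv_mul_cancel_right x g₀⟩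
    · rintro _ ⟨g, hg, rfl⟩
      exact pow_add S m m₀ ▸ Set.mul_mem_mul hm (interior_subset hg)

theorem image_mk (hS : IsSymmCompactGenSet S) (N : Subgroup G) [N.Normal] :
    IsSymmCompactGenSet (QuotientGroup.mk' N '' S) where
  isCompact := hS.isCompact.image continuous_quot_mk
  inv_mem := by
    rintro _ ⟨g, hg, rfl⟩
    exact ⟨g⁻¹, hS.inv_mem g hg, map_inv _ g⟩
  one_mem := ⟨1, hS.one_mem, map_one _⟩
  closure_eq_top := by
    rw [← MonoidHom.map_closure, hS.closure_eq_top]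
    exact Subgroup.map_top_of_surjective _ (QuotientGroup.mk'_surjective N)

end IsSymmCompactGenSet

/-! ### Cocycles -/

namespace BanachRep

variable {G : Type*} [Group G] [TopologicalSpace G]

theorem cocycle_one {ρ : BanachRep G} {b : G → ρ.E} (hb : b ∈ ρ.Z1) : b 1 = 0 := by
  simpa only [mul_one, map_one, one_apply_eq_self, left_eq_add] using hb.2 1 1

/-- The linear map that sends `x` to the coboundary `g ↦ x - ρ(g) x`. -/
def coboundary (ρ : BanachRep G) : ρ.E →ₗ[ℂ] (G → ρ.E) where
  toFun x g := x - ρ.toHom g x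
  map_add' x y := by
    ext g
    simp only [map_add, Pi.add_apply, add_sub_add_comm]
  map_smul' c x := by
    ext g
    simp only [map_smul, Pi.smul_apply, smul_sub, RingHom.id_apply]

theorem coboundary_apply (ρ : BanachRep G) (x : ρ.E) (g : G) :
    ρ.coboundary x g = x - ρ.toHom g x := rfl

theorem coboundary_mem_Z1 (ρ : BanachRep G) (x : ρ.E) : ρ.coboundary x ∈ ρ.Z1 := by
  refine ⟨continuous_const.sub (ρ.continuous_orbit x), fun g h => ?_⟩
  simp only [coboundary_apply, map_mul, map_sub, mul_apply_eq_comp]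
  abel

theorem norm_coboundary_le (ρ : BanachRep G) {C : ℝ} (x : ρ.E) {g : G} (hg : ‖ρ.toHom g‖ ≤ C) :
    ‖ρ.coboundary x g‖ ≤ (1 + C) * ‖x‖ :=
  calc ‖x - ρ.toHom g x‖ ≤ ‖x‖ + C * ‖x‖ :=
        (norm_sub_le _ _).trans (add_le_add_right ((ρ.toHom g).le_of_opNorm_le hg x) _)
    _ = (1 + C) * ‖x‖ := by ring

theorem subsingleton_H1_iff {ρ : BanachRep G} :
    Subsingleton ρ.H1 ↔ ∀ b ∈ ρ.Z1, ∃ x, b = ρ.coboundary x := by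
  simp only [H1, Submodule.Quotient.subsingleton_iff, Submodule.submoduleOf_eq_top, SetLike.le_def,
    funext_iff]
  rfl

theorem pullback_mem_Z1 {N : Subgroup G} [N.Normal] {σ : BanachRep (G ⧸ N)}
    {β : G ⧸ N → σ.E} (hβ : β ∈ σ.Z1) : (fun g : G => β g) ∈ (σ.pullback N).Z1 :=
  ⟨hβ.1.comp continuous_quot_mk, fun g h => hβ.2 g h⟩

/-- The representation of `G ⧸ N` defined by a representation of `G` that is trivial on `N`. -/
abbrev descend (ρ : BanachRep G) (N : Subgroup G) [N.Normal]
    (h : ∀ n ∈ N, ρ.toHom n = 1) : BanachRep (G ⧸ N) where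
  E := ρ.E
  toHom := QuotientGroup.lift N ρ.toHom h
  continuous_orbit x := by
    rw [(QuotientGroup.isQuotientMap_mk N).continuous_iff]
    exact ρ.continuous_orbit x

theorem exists_descend_cocycle (ρ : BanachRep G) (N : Subgroup G) [N.Normal]
    (h : ∀ n ∈ N, ρ.toHom n = 1) {b : G → ρ.E} (hb : b ∈ ρ.Z1) (hbN : ∀ n ∈ N, b n = 0) :
    ∃ β ∈ (ρ.descend N h).Z1, ∀ g : G, β (g : G ⧸ N) = b g := by
  have hb_coset : ∀ g g' : G, (g : G ⧸ N) = g' → b g = b g' := by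
    intro g g' hg
    have hmul := hb.2 g (g⁻¹ * g')
    rw [mul_inv_cancel_left, hbN _ (QuotientGroup.eq.1 hg), map_zero, add_zero] at hmul
    exact hmul.symm
  let β : G ⧸ N → ρ.E := fun x => b x.out
  have hβ : ∀ g : G, β (g : G ⧸ N) = b g := fun g => hb_coset _ _ (QuotientGroup.out_eq' _)
  refine ⟨β, ⟨?_, fun x y => ?_⟩, hβ⟩
  · exact (QuotientGroup.isQuotientMap_mk N).continuous_iff.2 (hb.1.congr fun g => (hβ g).symm)
  · obtain ⟨g, rfl⟩ := QuotientGroup.mk_surjective x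
    obtain ⟨g', rfl⟩ := QuotientGroup.mk_surjective y
    rw [← QuotientGroup.mk_mul]
    change β _ = β _ + ρ.toHom g (β _)
    rw [hβ, hβ, hβ]
    exact hb.2 g g'

section Smoothing

variable [IsTopologicalGroup G] [LocallyCompactSpace G] (ρ : BanachRep G) {f : C_c(G, ℂ)}
  {b : G → ρ.E}

theorem haarAverage_coboundary (hf : haarIntegral f = 1) (x : ρ.E) :
    haarAverage f (ρ.coboundary x) = x - ρ.op f x := by
  have h := haarAverage_sub f (continuous_const (y := x)) (ρ.continuous_orbit x)
  rwa [haarAverage_const, hf, one_smul] at h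

theorem haarAverage_cocycle_mul (hf : haarIntegral f = 1) (hb : b ∈ ρ.Z1) (g : G) :
    haarAverage f (fun h => b (g * h)) = b g + ρ.toHom g (haarAverage f b) := by
  have h := haarAverage_add f (continuous_const (y := b g)) ((ρ.toHom g).continuous.comp hb.1)
  simp only [Function.comp_apply, haarAverage_const, hf, one_smul] at h
  simpa only [hb.2 g, Function.comp_def, haarAverage_map f _ hb.1] using h

/-- The cocycle `b` after moving the base point of the affine action `x ↦ ρ(g) x + b(g)` from `0`
to the average `∫ f b`. -/
noncomputable def smoothing (f : C_c(G, ℂ)) (b : G → ρ.E) : G → ρ.E :=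
  b - ρ.coboundary (haarAverage f b)

theorem smoothing_mem_Z1 (f : C_c(G, ℂ)) (hb : b ∈ ρ.Z1) : ρ.smoothing f b ∈ ρ.Z1 :=
  ρ.Z1.sub_mem hb (ρ.coboundary_mem_Z1 _)

theorem smoothing_apply (f : C_c(G, ℂ)) (b : G → ρ.E) (g : G) :
    ρ.smoothing f b g = b g - (haarAverage f b - ρ.toHom g (haarAverage f b)) := rfl

theorem smoothing_coboundary (hf : haarIntegral f = 1) (x : ρ.E) :
    ρ.smoothing f (ρ.coboundary x) = ρ.coboundary (ρ.op f x) := by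
  rw [smoothing, ρ.haarAverage_coboundary hf, map_sub, sub_sub_cancel]

theorem smoothing_smul (f : C_c(G, ℂ)) (c : ℂ) (b : G → ρ.E) :
    ρ.smoothing f (c • b) = c • ρ.smoothing f b := by
  have h : haarAverage f (c • b) = c • haarAverage f b := by
    borelize G
    simp only [haarAverage, Pi.smul_apply, smul_comm _ c]
    exact integral_smul c _
  rw [smoothing, h, map_smul, smoothing, smul_sub]

theorem smoothing_sub_smoothing (hf : haarIntegral f = 1) (hb : b ∈ ρ.Z1) (g g₀ : G) :
    ρ.smoothing f b g - ρ.smoothing f b g₀ =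
      haarAverage f (fun h => b (g * h)) - haarAverage f (fun h => b (g₀ * h)) := by
  simp only [smoothing_apply, ρ.haarAverage_cocycle_mul hf hb]
  abel

theorem haarAverage_convolve_cocycle {k : C_c(G, ℂ)} (hf : haarIntegral f = 1)
    (hk : haarIntegral k = 1) (hb : b ∈ ρ.Z1) :
    haarAverage (convolve f k) b = haarAverage k b + haarAverage f (ρ.smoothing k b) := by
  have h_move : ∀ g, b g + ρ.toHom g (haarAverage k b) = haarAverage k b + ρ.smoothing k b g :=
    fun g => by rw [smoothing_apply]; abel
  rw [haarAverage_convolve f k hb.1]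
  simp only [ρ.haarAverage_cocycle_mul hk hb, h_move]
  rw [haarAverage_add f continuous_const (ρ.smoothing_mem_Z1 k hb).1, haarAverage_const, hf,
    one_smul]

theorem smoothing_convolve {k : C_c(G, ℂ)} (hf : haarIntegral f = 1) (hk : haarIntegral k = 1)
    (hb : b ∈ ρ.Z1) : ρ.smoothing (convolve f k) b = ρ.smoothing f (ρ.smoothing k b) := by
  rw [smoothing, ρ.haarAverage_convolve_cocycle hf hk hb, map_add, ← sub_sub, smoothing, smoothing]

/-- Averaging against `f` shrinks the cocycle `b` on `S`, by the factor `κ` at least. -/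
def Contracts (S : Set G) (f : C_c(G, ℂ)) (κ : ℝ) (b : G → ρ.E) : Prop :=
  ∀ D : ℝ, (∀ s ∈ S, ‖b s‖ ≤ D) → ∀ s ∈ S, ‖ρ.smoothing f b s‖ ≤ κ * D

end Smoothing

end BanachRep

/-! ### Uniform bounds over `BddRep S M` -/

namespace BddRep

open scoped Pointwise

variable {G : Type*} [Group G] [TopologicalSpace G] {S : Set G}

theorem norm_toHom_le_of_mem_pow {M : ℝ} (ρ : BddRep S M) (m : ℕ) :
    ∀ g ∈ S ^ m, ‖ρ.1.toHom g‖ ≤ max 1 M ^ m := by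
  induction m with
  | zero =>
    rintro g rfl
    rw [map_one, pow_zero]
    exact ContinuousLinearMap.norm_id_le
  | succ m ih =>
    rw [pow_succ]
    rintro _ ⟨g, hg, s, hs, rfl⟩
    rw [map_mul, pow_succ]
    exact norm_mul_le_of_le (ih g hg) ((ρ.2 s hs).trans (le_max_right 1 M))

theorem norm_cocycle_le_of_mem_pow {M : ℝ} (ρ : BddRep S M) {b : G → ρ.1.E} (hb : b ∈ ρ.1.Z1)
    {D : ℝ} (hD : ∀ s ∈ S, ‖b s‖ ≤ D) (m : ℕ) :
    ∀ g ∈ S ^ m, ‖b g‖ ≤ m * max 1 M ^ m * D := by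
  induction m with
  | zero =>
    rintro g rfl
    simp only [BanachRep.cocycle_one hb, norm_zero, CharP.cast_eq_zero, zero_mul, le_refl]
  | succ m ih =>
    rw [pow_succ]
    rintro _ ⟨g, hg, s, hs, rfl⟩
    have hD0 : 0 ≤ D := (norm_nonneg _).trans (hD s hs)
    have hpow : max 1 M ^ m ≤ max 1 M ^ (m + 1) :=
      pow_le_pow_right₀ (le_max_left 1 M) m.le_succ
    calc ‖b (g * s)‖ ≤ ‖b g‖ + ‖ρ.1.toHom g (b s)‖ := hb.2 g s ▸ norm_add_le _ _
      _ ≤ m * max 1 M ^ m * D + max 1 M ^ m * D := add_le_add (ih g hg)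
          ((ρ.1.toHom g).le_of_opNorm_le_of_le (ρ.norm_toHom_le_of_mem_pow m g hg) (hD s hs))
      _ = (m + 1) * max 1 M ^ m * D := by ring
      _ ≤ (m + 1) * max 1 M ^ (m + 1) * D := by gcongr
      _ = _ := by rw [Nat.cast_succ]

theorem cocycle_eq_zero (hS : IsSymmCompactGenSet S) {M : ℝ} (ρ : BddRep S M) {b : G → ρ.1.E}
    (hb : b ∈ ρ.1.Z1) (hbS : ∀ s ∈ S, ‖b s‖ ≤ 0) : b = 0 := by
  ext g
  obtain ⟨m, hm⟩ := hS.exists_mem_pow g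
  exact norm_le_zero_iff.1 ((ρ.norm_cocycle_le_of_mem_pow hb hbS m g hm).trans_eq (mul_zero _))

variable [IsTopologicalGroup G] [LocallyCompactSpace G]

theorem contracts_of_normalized (hS : IsSymmCompactGenSet S) {M : ℝ} (ρ : BddRep S M)
    {f : C_c(G, ℂ)} {κ : ℝ} {b : G → ρ.1.E} (hb : b ∈ ρ.1.Z1)
    (h : ∀ c : ℂ, (∀ s ∈ S, ‖(c • b) s‖ ≤ 1) → ∀ s ∈ S, ‖ρ.1.smoothing f (c • b) s‖ ≤ κ) :
    ρ.1.Contracts S f κ b := by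
  intro D hD s hs
  rcases ((norm_nonneg _).trans (hD s hs)).eq_or_lt with rfl | hDpos
  · have hzero := ρ.1.smoothing_smul f 0 b
    rw [zero_smul, zero_smul] at hzero
    rw [ρ.cocycle_eq_zero hS hb hD, hzero, Pi.zero_apply, norm_zero, mul_zero]
  · have hnorm : ∀ x : ρ.1.E, ‖(D : ℂ)⁻¹ • x‖ = D⁻¹ * ‖x‖ := fun x => by
      rw [norm_smul, norm_inv, Complex.norm_real, Real.norm_of_nonneg hDpos.le]
    have hκ := h (D : ℂ)⁻¹ (fun t ht => by
      rw [Pi.smul_apply, hnorm]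
      exact inv_mul_le_one_of_le₀ (hD t ht) hDpos.le) s hs
    rw [ρ.1.smoothing_smul, Pi.smul_apply, hnorm, inv_mul_le_iff₀ hDpos] at hκ
    rwa [mul_comm]

variable [T2Space G]

theorem exists_norm_toHom_le (hS : IsSymmCompactGenSet S) (M : ℝ) {K : Set G}
    (hK : IsCompact K) : ∃ C : ℝ, ∀ ρ : BddRep S M, ∀ g ∈ K, ‖ρ.1.toHom g‖ ≤ C := by
  obtain ⟨m, hm⟩ := hS.exists_subset_pow hK
  exact ⟨max 1 M ^ m, fun ρ g hg => ρ.norm_toHom_le_of_mem_pow m g (hm hg)⟩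

theorem exists_norm_cocycle_le (hS : IsSymmCompactGenSet S) (M : ℝ) {K : Set G}
    (hK : IsCompact K) : ∃ C : ℝ, 0 ≤ C ∧ ∀ ρ : BddRep S M, ∀ b ∈ ρ.1.Z1, ∀ D : ℝ,
      (∀ s ∈ S, ‖b s‖ ≤ D) → ∀ g ∈ K, ‖b g‖ ≤ C * D := by
  obtain ⟨m, hm⟩ := hS.exists_subset_pow hK
  exact ⟨m * max 1 M ^ m, by positivity,
    fun ρ b hb D hD g hg => ρ.norm_cocycle_le_of_mem_pow hb hD m g (hm hg)⟩

theorem exists_norm_smoothing_le (hS : IsSymmCompactGenSet S) (M : ℝ) (φ : C_c(G, ℂ))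
    {K : Set G} (hK : IsCompact K) : ∃ C : ℝ, ∀ ρ : BddRep S M, ∀ b ∈ ρ.1.Z1,
      (∀ s ∈ S, ‖b s‖ ≤ 1) → ∀ g ∈ K, ‖ρ.1.smoothing φ b g‖ ≤ C := by
  obtain ⟨Cρ, hCρ⟩ := exists_norm_toHom_le hS M hK
  obtain ⟨C, -, hC⟩ := exists_norm_cocycle_le hS M hK
  obtain ⟨Cφ, -, hCφ⟩ := exists_norm_cocycle_le hS M φ.hasCompactSupport.isCompact
  refine ⟨C * 1 + (1 + Cρ) * (l1Norm φ * (Cφ * 1)), fun ρ b hb hb1 g hg => ?_⟩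
  have hCρ0 : 0 ≤ Cρ := (norm_nonneg _).trans (hCρ ρ g hg)
  refine (norm_sub_le _ _).trans (add_le_add (hC ρ b hb 1 hb1 g hg) ?_)
  refine (ρ.1.norm_coboundary_le _ (hCρ ρ g hg)).trans
    (mul_le_mul_of_nonneg_left ?_ (by positivity))
  exact norm_haarAverage_le φ (hCφ ρ b hb 1 hb1)

/- The difference of the two averages is the average of `b` against the difference of two
translates of `φ`, whose `L¹` norm is small, on a compact set where `b` is bounded. -/
theorem eventually_norm_haarAverage_cocycle_sub_le (hS : IsSymmCompactGenSet S) (M : ℝ)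
    (φ : C_c(G, ℂ)) (g₀ : G) {η : ℝ} (hη : 0 < η) :
    ∀ᶠ g in 𝓝 g₀, ∀ ρ : BddRep S M, ∀ b ∈ ρ.1.Z1, (∀ s ∈ S, ‖b s‖ ≤ 1) →
      ‖haarAverage φ (fun h => b (g * h)) - haarAverage φ (fun h => b (g₀ * h))‖ ≤ η := by
  obtain ⟨K, hK, hKg₀⟩ := exists_compact_mem_nhds g₀
  have hg₀ : g₀ ∈ K := mem_of_mem_nhds hKg₀
  let L : Set G := K * tsupport φ
  have hL : IsCompact L := hK.mul φ.hasCompactSupport.isCompact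
  have hφ : ∀ g ∈ K, ∀ h ∉ L, φ (g⁻¹ * h) = 0 := fun g hg h hh =>
    image_eq_zero_of_notMem_tsupport fun h' => hh ⟨g, hg, g⁻¹ * h, h', mul_inv_cancel_left g h⟩
  obtain ⟨C, -, hC⟩ := exists_norm_cocycle_le hS M hL
  have hlim : Filter.Tendsto
      (fun g => l1Norm (leftTranslate g φ - leftTranslate g₀ φ) * (C * 1)) (𝓝 g₀) (𝓝 0) := by
    have hcont := (continuousOn_l1Norm_leftTranslate_sub hL φ hg₀ hφ).continuousAt hKg₀
    have hzero : l1Norm (0 : C_c(G, ℂ)) = 0 := by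
      borelize G
      exact (integral_congr_ae (.of_forall fun _ => norm_zero)).trans (integral_zero _ _)
    simpa only [sub_self, hzero, zero_mul] using hcont.tendsto.mul_const (C * 1)
  filter_upwards [hlim.eventually_lt_const hη, hKg₀] with g hg hgK ρ b hb hb1
  rw [← haarAverage_leftTranslate, ← haarAverage_leftTranslate, ← haarAverage_sub_left _ _ hb.1]
  refine (norm_haarAverage_le _ fun h hh => hC ρ b hb 1 hb1 h ?_).trans hg.le
  refine closure_minimal (fun x hx => ?_) hL.isClosed hh
  by_contra hxL
  refine hx ?_
  rw [CompactlySupportedContinuousMap.sub_apply, leftTranslate_apply, leftTranslate_apply,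
    hφ g hgK x hxL, hφ g₀ hg₀ x hxL, sub_zero]

end BddRep

/-! ### Kazhdan projections contract cocycles -/

section KazhdanContraction

variable {G : Type*} [Group G] [TopologicalSpace G]

theorem OpFamily.norm_sub_le_of_supDist {F : Set (BanachRep G)} {p q : OpFamily F} {ε : ℝ}
    (hε : 0 ≤ ε) (h : OpFamily.supDist p q ≤ ENNReal.ofReal ε) (ρ : F) : ‖p ρ - q ρ‖ ≤ ε := by
  rw [← ENNReal.ofReal_le_ofReal_iff hε, ofReal_norm]
  exact (le_iSup (fun ρ => ‖p ρ - q ρ‖ₑ) ρ).trans h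

variable [IsTopologicalGroup G] [LocallyCompactSpace G]

namespace IsKazhdanProjection

variable {F : Set (BanachRep G)} {p : OpFamily F}

theorem exists_norm_sub_op_le (hp : IsKazhdanProjection F p) {ε : ℝ} (hε : 0 < ε) :
    ∃ f : C_c(G, ℂ), haarIntegral f = 1 ∧ ∀ ρ : F, ‖p ρ - ρ.1.op f‖ ≤ ε := by
  obtain ⟨f, hf, hpf⟩ := hp.mem_closure (ENNReal.ofReal ε) (ENNReal.ofReal_pos.2 hε)
  exact ⟨f, hf, OpFamily.norm_sub_le_of_supDist hε.le hpf.le⟩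

theorem exists_mem_ker_coboundary_eq (hp : IsKazhdanProjection F p) (ρ : F) (x : ρ.1.E) :
    ∃ y, p ρ y = 0 ∧ ρ.1.coboundary y = ρ.1.coboundary x := by
  obtain ⟨h_idem, h_range⟩ := hp.projection ρ
  have h_inv : p ρ x ∈ ρ.1.invariants := h_range ▸ ⟨x, rfl⟩
  refine ⟨x - p ρ x, ?_, ?_⟩
  · rw [map_sub, sub_eq_zero]
    exact (DFunLike.congr_fun h_idem x).symm
  · ext g
    rw [ρ.1.coboundary_apply, map_sub, h_inv g, sub_sub_sub_cancel_right, ρ.1.coboundary_apply]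

end IsKazhdanProjection

theorem BanachRep.norm_op_le_of_map_eq_zero (ρ : BanachRep G) {P : ρ.E →L[ℂ] ρ.E} {f : C_c(G, ℂ)}
    {ε : ℝ} (hP : ‖P - ρ.op f‖ ≤ ε) {x : ρ.E} (hx : P x = 0) : ‖ρ.op f x‖ ≤ ε * ‖x‖ := by
  simpa only [sub_apply, hx, zero_sub, norm_neg]
    using (P - ρ.op f).le_of_opNorm_le hP x

theorem BanachRep.norm_le_of_norm_coboundary_le (ρ : BanachRep G) {f : C_c(G, ℂ)}
    (hf : haarIntegral f = 1) {x : ρ.E} (hx : ‖ρ.op f x‖ ≤ 1 / 2 * ‖x‖) {B : ℝ}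
    (hB : ∀ g ∈ tsupport f, ‖ρ.coboundary x g‖ ≤ B) : ‖x‖ ≤ 2 * (l1Norm f * B) := by
  have h_avg : ‖x - ρ.op f x‖ ≤ l1Norm f * B :=
    ρ.haarAverage_coboundary hf x ▸ norm_haarAverage_le f hB
  linarith [norm_sub_norm_le x (ρ.op f x)]

theorem HasKazhdanProjection.exists_contracts [T2Space G] {S : Set G}
    (hS : IsSymmCompactGenSet S) {M : ℝ} {F : Set (BanachRep G)}
    (hF : ∀ σ ∈ F, ∀ g ∈ S, ‖σ.toHom g‖ ≤ M) (hK : HasKazhdanProjection F)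
    (hH1 : ∀ σ ∈ F, Subsingleton σ.H1) {κ : ℝ} (hκ : 0 < κ) :
    ∃ f : C_c(G, ℂ), haarIntegral f = 1 ∧ ∀ σ ∈ F, ∀ β ∈ σ.Z1, σ.Contracts S f κ β := by
  obtain ⟨p, hp⟩ := hK
  obtain ⟨f₁, hf₁, hpf₁⟩ := hp.exists_norm_sub_op_le (ε := 1 / 2) (by norm_num)
  obtain ⟨C, -, hC⟩ := BddRep.exists_norm_cocycle_le hS M f₁.hasCompactSupport.isCompact
  let C₀ : ℝ := 2 * (l1Norm f₁ * C)
  let ε : ℝ := κ / ((1 + |M|) * (|C₀| + 1))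
  obtain ⟨f, hf, hpf⟩ := hp.exists_norm_sub_op_le (ε := ε) (by positivity)
  refine ⟨f, hf, fun σ hσ β hβ D hD g hg => ?_⟩
  have hD0 : 0 ≤ D := (norm_nonneg _).trans (hD 1 hS.one_mem)
  obtain ⟨x, hx⟩ := BanachRep.subsingleton_H1_iff.1 (hH1 σ hσ) β hβ
  obtain ⟨y, hpy, hyx⟩ := hp.exists_mem_ker_coboundary_eq ⟨σ, hσ⟩ x
  obtain rfl : β = σ.coboundary y := hx.trans hyx.symm
  have hy : ‖y‖ ≤ (|C₀| + 1) * D :=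
    calc ‖y‖ ≤ 2 * (l1Norm f₁ * (C * D)) := σ.norm_le_of_norm_coboundary_le hf₁
          (σ.norm_op_le_of_map_eq_zero (hpf₁ ⟨σ, hσ⟩) hpy) (hC ⟨σ, hF σ hσ⟩ _ hβ D hD)
      _ = C₀ * D := by ring
      _ ≤ (|C₀| + 1) * D := by gcongr; linarith [le_abs_self C₀]
  rw [σ.smoothing_coboundary hf]
  calc ‖σ.coboundary (σ.op f y) g‖ ≤ (1 + |M|) * ‖σ.op f y‖ :=
        σ.norm_coboundary_le _ ((hF σ hσ g hg).trans (le_abs_self M))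
    _ ≤ (1 + |M|) * (ε * ((|C₀| + 1) * D)) := by
        gcongr
        exact (σ.norm_op_le_of_map_eq_zero (hpf ⟨σ, hσ⟩) hpy).trans
          (mul_le_mul_of_nonneg_left hy (by positivity))
    _ = κ * D := by
        simp only [ε]
        field_simp

end KazhdanContraction

/-! ### Intertwining operators -/

namespace BanachRep

variable {G : Type*} [Group G] [TopologicalSpace G]

/-- Bounded operators that intertwine two representations. -/
structure Hom (ρ ρ' : BanachRep G) where
  toCLM : ρ.E →L[ℂ] ρ'.E
  map_toHom : ∀ g x, toCLM (ρ.toHom g x) = ρ'.toHom g (toCLM x)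

namespace Hom

variable {ρ ρ' : BanachRep G} (u : Hom ρ ρ') {b : G → ρ.E}

theorem map_mem_Z1 (hb : b ∈ ρ.Z1) : (fun g => u.toCLM (b g)) ∈ ρ'.Z1 :=
  ⟨u.toCLM.continuous.comp hb.1, fun g h => by simp only [hb.2 g h, map_add, u.map_toHom]⟩

variable [IsTopologicalGroup G] [LocallyCompactSpace G]

theorem map_op (f : C_c(G, ℂ)) (x : ρ.E) : u.toCLM (ρ.op f x) = ρ'.op f (u.toCLM x) := by
  rw [ρ.op_eq_haarAverage, ← haarAverage_map f u.toCLM (ρ.continuous_orbit x),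
    ρ'.op_eq_haarAverage]
  simp only [u.map_toHom]

theorem map_smoothing (f : C_c(G, ℂ)) (hb : Continuous b) (g : G) :
    u.toCLM (ρ.smoothing f b g) = ρ'.smoothing f (fun h => u.toCLM (b h)) g := by
  rw [smoothing_apply, smoothing_apply, haarAverage_map f u.toCLM hb, map_sub, map_sub,
    u.map_toHom]

end Hom

end BanachRep

/-! ### The representation spanned by a cocycle -/

section CocycleRep

variable {X Y : Type} [NormedAddCommGroup X] [NormedSpace ℂ X] [NormedAddCommGroup Y]
  [NormedSpace ℂ Y]

/-- The closed subspace spanned by the values of `x`. -/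
abbrev closedSpan {α : Type*} (x : α → X) : Submodule ℂ X :=
  (Submodule.span ℂ (Set.range x)).topologicalClosure

theorem mem_closedSpan {α : Type*} (x : α → X) (a : α) : x a ∈ closedSpan x :=
  subset_closure (Submodule.subset_span ⟨a, rfl⟩)

theorem closedSpan_le {α : Type*} {x : α → X} {V : Submodule ℂ X} (hV : IsClosed (V : Set X))
    (hx : ∀ a, x a ∈ V) : closedSpan x ≤ V :=
  Submodule.topologicalClosure_minimal _ (Submodule.span_le.2 (Set.range_subset_iff.2 hx)) hV

theorem isSeparable_closedSpan {α : Type*} [TopologicalSpace α] [SigmaCompactSpace α]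
    {x : α → X} (hx : Continuous x) : TopologicalSpace.IsSeparable (closedSpan x : Set X) := by
  refine (TopologicalSpace.IsSeparable.span ?_).closure
  rw [← Set.image_univ, ← iUnion_compactCovering, Set.image_iUnion]
  exact .iUnion fun n => ((isCompact_compactCovering α n).image hx).isSeparable

variable {G : Type*} [Group G] [TopologicalSpace G]

/-- The subspace of vectors with continuous orbit map. -/
def continuousVectors (T : G →* (X →L[ℂ] X)) : Submodule ℂ X where
  carrier := {v | Continuous fun g => T g v}
  add_mem' {v w} hv hw := by
    change Continuous fun g => T g (v + w)
    simp only [map_add]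
    exact Continuous.add hv hw
  zero_mem' := by
    change Continuous fun g => T g 0
    simp only [map_zero]
    exact continuous_const
  smul_mem' c v hv := by
    change Continuous fun g => T g (c • v)
    simp only [map_smul]
    exact Continuous.const_smul hv c

theorem isClosed_continuousVectors {T : G →* (X →L[ℂ] X)}
    (hT : ∀ g₀, ∃ C, ∀ᶠ g in 𝓝 g₀, ‖T g‖ ≤ C) : IsClosed (continuousVectors T : Set X) := by
  refine isClosed_of_closure_subset fun v hv => continuous_iff_continuousAt.2 fun g₀ => ?_
  obtain ⟨C, hC⟩ := hT g₀
  refine continuousAt_of_locally_uniform_approx_of_continuousAt fun s hs => ?_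
  obtain ⟨ε, hε, hεs⟩ := Metric.mem_uniformity_dist.1 hs
  obtain ⟨w, hw, hvw⟩ := Metric.mem_closure_iff.1 hv (ε / (|C| + 1)) (by positivity)
  refine ⟨_, hC, fun g => T g w, Continuous.continuousAt hw, fun g hg => hεs ?_⟩
  calc dist (T g v) (T g w) ≤ (|C| + 1) * dist v w := by
        rw [dist_eq_norm, dist_eq_norm, ← map_sub]
        exact (T g).le_of_opNorm_le (hg.trans (by linarith [le_abs_self C])) _
    _ < ε := by rwa [lt_div_iff₀' (by positivity)] at hvw

/-- `x` is a continuous cocycle for a locally bounded, but not necessarily continuous, action of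
`G` by bounded operators. -/
structure IsLocallyBoundedCocycle (T : G →* (X →L[ℂ] X)) (x : G → X) : Prop where
  locally_bounded : ∀ g₀, ∃ C, ∀ᶠ g in 𝓝 g₀, ‖T g‖ ≤ C
  continuous : Continuous x
  map_mul : ∀ g h, x (g * h) = x g + T g (x h)

namespace IsLocallyBoundedCocycle

variable {T : G →* (X →L[ℂ] X)} {x : G → X} {T' : G →* (Y →L[ℂ] Y)} {x' : G → Y}

theorem map_mem_closedSpan (h : IsLocallyBoundedCocycle T x) (g : G) :
    ∀ v ∈ closedSpan x, T g v ∈ closedSpan x := by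
  refine closedSpan_le (V := (closedSpan x).comap (T g).toLinearMap)
    (isClosed_closure.preimage (T g).continuous) fun k => ?_
  have hTx : T g (x k) = x (g * k) - x g := by rw [h.map_mul, add_sub_cancel_left]
  exact Submodule.mem_comap.2 (hTx ▸ sub_mem (mem_closedSpan x _) (mem_closedSpan x _))

theorem continuous_orbit [ContinuousMul G] (h : IsLocallyBoundedCocycle T x) :
    ∀ v ∈ closedSpan x, Continuous fun g => T g v := by
  refine closedSpan_le (isClosed_continuousVectors h.locally_bounded) fun k => ?_
  have hTx : (fun g => T g (x k)) = fun g => x (g * k) - x g := by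
    simp only [h.map_mul, add_sub_cancel_left]
  exact (hTx ▸ (h.continuous.comp (continuous_mul_const k)).sub h.continuous :
    Continuous fun g => T g (x k))

variable [ContinuousMul G] [CompleteSpace X] [CompleteSpace Y] [SigmaCompactSpace G]

/-- The continuous representation on the closed span of the values of a cocycle. -/
noncomputable abbrev rep (h : IsLocallyBoundedCocycle T x) : BanachRep G where
  E := closedSpan x
  separable := (isSeparable_closedSpan h.continuous).separableSpace
  toHom :=
    { toFun g := (T g).restrict (h.map_mem_closedSpan g)
      map_one' := by
        ext v
        simp
      map_mul' g k := by
        ext v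
        simp }
  continuous_orbit v := (h.continuous_orbit v v.2).subtype_mk _

/-- The cocycle `x`, with values in the representation spanned by `x`. -/
def cocycle (h : IsLocallyBoundedCocycle T x) (g : G) : h.rep.E := ⟨x g, mem_closedSpan x g⟩

theorem cocycle_mem_Z1 (h : IsLocallyBoundedCocycle T x) : h.cocycle ∈ h.rep.Z1 :=
  ⟨h.continuous.subtype_mk _, fun g k => Subtype.ext (h.map_mul g k)⟩

/-- The intertwining operator of spanned representations induced by an equivariant operator `u`
that maps the cocycle `x` to `x'`. -/
noncomputable abbrev hom (h : IsLocallyBoundedCocycle T x) (h' : IsLocallyBoundedCocycle T' x')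
    (u : X →L[ℂ] Y) (hu : ∀ g v, u (T g v) = T' g (u v)) (hx : ∀ g, u (x g) = x' g) :
    BanachRep.Hom h.rep h'.rep where
  toCLM := u.restrict <| closedSpan_le (V := (closedSpan x').comap u.toLinearMap)
    (isClosed_closure.preimage u.continuous) fun g => Submodule.mem_comap.2 <|
      (hx g).symm ▸ mem_closedSpan x' g
  map_toHom g v := Subtype.ext (hu g v)

theorem denseRange_hom (h : IsLocallyBoundedCocycle T x) (h' : IsLocallyBoundedCocycle T' x')
    (u : X →L[ℂ] Y) (hu : ∀ g v, u (T g v) = T' g (u v)) (hx : ∀ g, u (x g) = x' g) :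
    DenseRange (h.hom h' u hu hx).toCLM := by
  let V := (LinearMap.range (u ∘L (closedSpan x).subtypeL).toLinearMap).topologicalClosure
  have hV : closedSpan x' ≤ V := closedSpan_le isClosed_closure fun g =>
    subset_closure ⟨h.cocycle g, hx g⟩
  refine Subtype.dense_iff.2 fun v hv => closure_mono ?_ (hV hv)
  rintro _ ⟨w, rfl⟩
  exact ⟨_, ⟨w, rfl⟩, rfl⟩

end IsLocallyBoundedCocycle

end CocycleRep

/-! ### Banach ultraproducts -/

section Ultraproduct

variable {ι : Type} {E : ι → Type} [∀ i, NormedAddCommGroup (E i)] [∀ i, NormedSpace ℂ (E i)]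

/-- The bounded families whose norms tend to `0` along `U`. -/
def nullFamilies (E : ι → Type) [∀ i, NormedAddCommGroup (E i)] [∀ i, NormedSpace ℂ (E i)]
    (U : Ultrafilter ι) : Submodule ℂ (lp E ∞) where
  carrier := {u | Filter.Tendsto (fun i => ‖u i‖) U (𝓝 0)}
  add_mem' {u v} hu hv := squeeze_zero (fun _ => norm_nonneg _) (fun i => norm_add_le (u i) (v i))
    (by simpa only [add_zero] using Filter.Tendsto.add hu hv)
  zero_mem' := by
    change Filter.Tendsto (fun i => ‖(0 : lp E ∞) i‖) U (𝓝 0)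
    simp only [lp.coeFn_zero, Pi.zero_apply, norm_zero, tendsto_const_nhds]
  smul_mem' c u hu := by
    change Filter.Tendsto (fun i => ‖(c • u) i‖) U (𝓝 0)
    simpa only [lp.coeFn_smul, Pi.smul_apply, norm_smul, mul_zero]
      using Filter.Tendsto.const_mul ‖c‖ hu

variable {U : Ultrafilter ι}

theorem mem_nullFamilies {u : lp E ∞} :
    u ∈ nullFamilies E U ↔ Filter.Tendsto (fun i => ‖u i‖) U (𝓝 0) := Iff.rfl

omit [∀ i, NormedSpace ℂ (E i)] in
theorem norm_coord_le (u : lp E ∞) (i : ι) : ‖u i‖ ≤ ‖u‖ :=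
  lp.norm_apply_le_norm ENNReal.top_ne_zero u i

instance isClosed_nullFamilies : IsClosed (nullFamilies E U : Set (lp E ∞)) := by
  refine isClosed_of_closure_subset fun u hu => ?_
  refine tendsto_order.2 ⟨fun r hr => .of_forall fun i => hr.trans_le (norm_nonneg _),
    fun r hr => ?_⟩
  obtain ⟨w, hw, huw⟩ := Metric.mem_closure_iff.1 hu (r / 2) (half_pos hr)
  filter_upwards [(mem_nullFamilies.1 hw).eventually_lt_const (half_pos hr)] with i hi
  rw [dist_eq_norm] at huw
  calc ‖u i‖ ≤ ‖(u - w) i‖ + ‖w i‖ := norm_le_norm_sub_add (u i) (w i)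
    _ < r := by linarith [norm_coord_le (u - w) i]

/-- The Banach ultraproduct of the spaces `E i`. -/
abbrev BanachUltraproduct (E : ι → Type) [∀ i, NormedAddCommGroup (E i)]
    [∀ i, NormedSpace ℂ (E i)] (U : Ultrafilter ι) : Type :=
  lp E ∞ ⧸ nullFamilies E U

theorem norm_mk_le_of_eventually {u : lp E ∞} {r : ℝ} (h : ∀ᶠ i in U, ‖u i‖ ≤ r) :
    ‖(nullFamilies E U).mkQL u‖ ≤ r := by
  obtain ⟨i₀, hi₀⟩ := h.exists
  have hr : 0 ≤ r := (norm_nonneg _).trans hi₀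
  classical
  let v : ∀ i, E i := fun i => if ‖u i‖ ≤ r then u i else 0
  have hv : ∀ i, ‖v i‖ ≤ r := fun i => by
    by_cases hi : ‖u i‖ ≤ r
    · simpa only [v, if_pos hi] using hi
    · simpa only [v, if_neg hi, norm_zero] using hr
  let w : lp E ∞ := ⟨v, memℓp_infty ⟨r, Set.forall_mem_range.2 hv⟩⟩
  have huw : u - w ∈ nullFamilies E U := by
    refine mem_nullFamilies.2 (tendsto_const_nhds.congr' (h.mono fun i hi => ?_))
    change 0 = ‖u i - v i‖
    simp only [v, if_pos hi, sub_self, norm_zero]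
  calc ‖(nullFamilies E U).mkQL u‖ = ‖(nullFamilies E U).mkQL w‖ :=
        congrArg norm ((Submodule.Quotient.eq _).2 huw)
    _ ≤ ‖w‖ := Submodule.Quotient.norm_mk_le _ w
    _ ≤ r := lp.norm_le_of_forall_le hr hv

theorem tendsto_norm_mk (u : lp E ∞) :
    Filter.Tendsto (fun i => ‖u i‖) U (𝓝 ‖(nullFamilies E U).mkQL u‖) := by
  refine tendsto_order.2 ⟨fun r hr => ?_, fun r hr => ?_⟩
  · by_contra h
    refine hr.not_ge (norm_mk_le_of_eventually ?_)
    simpa only [not_lt] using Ultrafilter.eventually_not.2 h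
  · obtain ⟨w, hw, hwr⟩ :=
      Submodule.Quotient.norm_mk_lt ((nullFamilies E U).mkQL u) (half_pos (sub_pos.2 hr))
    have huw : u - w ∈ nullFamilies E U := (Submodule.Quotient.eq _).1 hw.symm
    filter_upwards [(mem_nullFamilies.1 huw).eventually_lt_const (half_pos (sub_pos.2 hr))]
      with i hi
    calc ‖u i‖ ≤ ‖(u - w) i‖ + ‖w i‖ := norm_le_norm_sub_add (u i) (w i)
      _ < r := by linarith [norm_coord_le w i]

/-- A bounded family of operators, acting coordinatewise on bounded families of vectors. -/
noncomputable def diagonalOp (T : ∀ i, E i →L[ℂ] E i) (hT : ∃ C, ∀ i, ‖T i‖ ≤ C) :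
    lp E ∞ →L[ℂ] lp E ∞ :=
  LinearMap.mkContinuousOfExistsBound
    { toFun u := ⟨fun i => T i (u i), memℓp_infty <| by
        obtain ⟨C, hC⟩ := hT
        exact ⟨C * ‖u‖, Set.forall_mem_range.2 fun i =>
          (T i).le_of_opNorm_le_of_le (hC i) (norm_coord_le u i)⟩⟩
      map_add' u v := lp.ext <| funext fun i => map_add (T i) (u i) (v i)
      map_smul' c u := lp.ext <| funext fun i => map_smul (T i) c (u i) } <| by
    obtain ⟨C, hC⟩ := hT
    refine ⟨|C|, fun u => lp.norm_le_of_forall_le (by positivity) fun i => ?_⟩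
    exact (T i).le_of_opNorm_le_of_le ((hC i).trans (le_abs_self C)) (norm_coord_le u i)

theorem diagonalOp_apply {T : ∀ i, E i →L[ℂ] E i} (hT : ∃ C, ∀ i, ‖T i‖ ≤ C) (u : lp E ∞)
    (i : ι) : diagonalOp T hT u i = T i (u i) := rfl

theorem diagonalOp_mem_nullFamilies {T : ∀ i, E i →L[ℂ] E i} (hT : ∃ C, ∀ i, ‖T i‖ ≤ C)
    {u : lp E ∞} (hu : u ∈ nullFamilies E U) : diagonalOp T hT u ∈ nullFamilies E U := by
  have ⟨C, hC⟩ := hT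
  refine squeeze_zero (fun _ => norm_nonneg _) (fun i => (T i).le_of_opNorm_le (hC i) (u i)) ?_
  simpa only [mul_zero] using (mem_nullFamilies.1 hu).const_mul C

/-- The operator on the ultraproduct induced by a bounded family of operators. -/
noncomputable def ultraproductOp (U : Ultrafilter ι) (T : ∀ i, E i →L[ℂ] E i)
    (hT : ∃ C, ∀ i, ‖T i‖ ≤ C) : BanachUltraproduct E U →L[ℂ] BanachUltraproduct E U :=
  (nullFamilies E U).liftQL ((nullFamilies E U).mkQL ∘L diagonalOp T hT) fun _ hu =>
    (Submodule.Quotient.mk_eq_zero _).2 (diagonalOp_mem_nullFamilies hT hu)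

theorem norm_diagonalOp_le {T : ∀ i, E i →L[ℂ] E i} {C : ℝ} (hC0 : 0 ≤ C)
    (hC : ∀ i, ‖T i‖ ≤ C) : ‖diagonalOp T ⟨C, hC⟩‖ ≤ C :=
  ContinuousLinearMap.opNorm_le_bound _ hC0 fun u =>
    lp.norm_le_of_forall_le (by positivity) fun i =>
      (T i).le_of_opNorm_le_of_le (hC i) (norm_coord_le u i)

theorem norm_ultraproductOp_le {T : ∀ i, E i →L[ℂ] E i} {C : ℝ} (hC0 : 0 ≤ C)
    (hC : ∀ i, ‖T i‖ ≤ C) : ‖ultraproductOp U T ⟨C, hC⟩‖ ≤ C := by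
  refine ContinuousLinearMap.opNorm_le_bound _ hC0 fun z => ?_
  obtain ⟨u, rfl⟩ := Submodule.Quotient.mk_surjective _ z
  exact le_of_tendsto_of_tendsto (tendsto_norm_mk (diagonalOp T ⟨C, hC⟩ u))
    ((tendsto_norm_mk u).const_mul C) (.of_forall fun i => (T i).le_of_opNorm_le (hC i) (u i))

variable {G : Type*} [Group G] {T : ∀ i, G →* (E i →L[ℂ] E i)}

/-- The coordinatewise action of `G` on bounded families of vectors. -/
noncomputable def diagonalHom (hT : ∀ g, ∃ C, ∀ i, ‖T i g‖ ≤ C) :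
    G →* (lp E ∞ →L[ℂ] lp E ∞) where
  toFun g := diagonalOp (fun i => T i g) (hT g)
  map_one' := by
    ext u i
    simp [diagonalOp_apply]
  map_mul' g h := by
    ext u i
    simp [diagonalOp_apply]

/-- The action of `G` on the ultraproduct induced by actions on the factors. -/
noncomputable def ultraproductHom (U : Ultrafilter ι) (hT : ∀ g, ∃ C, ∀ i, ‖T i g‖ ≤ C) :
    G →* (BanachUltraproduct E U →L[ℂ] BanachUltraproduct E U) where
  toFun g := ultraproductOp U (fun i => T i g) (hT g)
  map_one' := by
    ext z
    obtain ⟨u, rfl⟩ := Submodule.Quotient.mk_surjective _ z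
    exact congrArg (nullFamilies E U).mkQL (DFunLike.congr_fun (map_one (diagonalHom hT)) u)
  map_mul' g h := by
    ext z
    obtain ⟨u, rfl⟩ := Submodule.Quotient.mk_surjective _ z
    exact congrArg (nullFamilies E U).mkQL (DFunLike.congr_fun (map_mul (diagonalHom hT) g h) u)

end Ultraproduct

/-! ### Ultralimits of representations -/

section UltraLimit

variable {G : Type*} [Group G] [TopologicalSpace G] {ι : Type}

/-- `W` maps equivariantly and contractively to each `ρ i`, and `L` is the completion of `W` for
the limit of the induced seminorms along `U`. -/
structure UltraLimit (U : Ultrafilter ι) (ρ : ι → BanachRep G) (W L : BanachRep G) where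
  eval : ∀ i, W.Hom (ρ i)
  toLimit : W.Hom L
  norm_eval_le : ∀ i w, ‖(eval i).toCLM w‖ ≤ ‖w‖
  denseRange : DenseRange toLimit.toCLM
  tendsto_norm : ∀ w, Filter.Tendsto (fun i => ‖(eval i).toCLM w‖) U (𝓝 ‖toLimit.toCLM w‖)

theorem exists_ultraLimit [IsTopologicalGroup G] [LocallyCompactSpace G] [T2Space G] {S : Set G}
    (hS : IsSymmCompactGenSet S) {M : ℝ} (U : Ultrafilter ι) (ρ : ι → BddRep S M)
    {x : G → lp (fun i => (ρ i).1.E) ∞} (hx : Continuous x)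
    (hx' : ∀ i, (fun g => x g i) ∈ (ρ i).1.Z1) :
    ∃ (W L : BanachRep G) (D : UltraLimit U (fun i => (ρ i).1) W L), ∃ w ∈ W.Z1,
      ∀ i g, (D.eval i).toCLM (w g) = x g i := by
  have _ := hS.sigmaCompactSpace
  have hT : ∀ g, ∃ C, ∀ i, ‖(ρ i).1.toHom g‖ ≤ C := fun g => by
    obtain ⟨C, hC⟩ := BddRep.exists_norm_toHom_le hS M (isCompact_singleton (x := g))
    exact ⟨C, fun i => hC (ρ i) g rfl⟩
  have h_bound : ∀ g₀, ∃ C, 0 ≤ C ∧ ∀ᶠ g in 𝓝 g₀, ∀ i, ‖(ρ i).1.toHom g‖ ≤ C := fun g₀ => by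
    obtain ⟨K, hK, hKg₀⟩ := exists_compact_mem_nhds g₀
    obtain ⟨C, hC⟩ := BddRep.exists_norm_toHom_le hS M hK
    exact ⟨|C|, abs_nonneg C, Filter.mem_of_superset hKg₀ fun g hg i =>
      (hC (ρ i) g hg).trans (le_abs_self C)⟩
  have hW : IsLocallyBoundedCocycle (diagonalHom hT) x :=
    { locally_bounded := fun g₀ => by
        obtain ⟨C, hC0, hC⟩ := h_bound g₀
        exact ⟨C, hC.mono fun g hg => norm_diagonalOp_le hC0 hg⟩
      continuous := hx
      map_mul := fun g h => lp.ext <| funext fun i => (hx' i).2 g h }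
  have hL : IsLocallyBoundedCocycle (ultraproductHom U hT) fun g => (nullFamilies _ U).mkQL (x g) :=
    { locally_bounded := fun g₀ => by
        obtain ⟨C, hC0, hC⟩ := h_bound g₀
        exact ⟨C, hC.mono fun g hg => norm_ultraproductOp_le hC0 hg⟩
      continuous := (nullFamilies _ U).mkQL.continuous.comp hx
      map_mul := fun g h => congrArg (nullFamilies _ U).mkQL (hW.map_mul g h) }
  let D : UltraLimit U (fun i => (ρ i).1) hW.rep hL.rep :=
    { eval := fun i =>
        { toCLM := lp.evalCLM ℂ _ ∞ i ∘L (closedSpan x).subtypeL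
          map_toHom := fun g v => rfl }
      toLimit := hW.hom hL (nullFamilies _ U).mkQL (fun _ _ => rfl) fun _ => rfl
      norm_eval_le := fun i w => norm_coord_le w.1 i
      denseRange := hW.denseRange_hom hL _ _ _
      tendsto_norm := fun w => tendsto_norm_mk w.1 }
  exact ⟨hW.rep, hL.rep, D, hW.cocycle, hW.cocycle_mem_Z1, fun i g => rfl⟩

end UltraLimit

section Closedness

variable {G : Type*} [Group G] [TopologicalSpace G] {ι : Type}

namespace UltraLimit

variable {U : Ultrafilter ι} {ρ : ι → BanachRep G} {W L : BanachRep G}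

theorem norm_toLimit_le (D : UltraLimit U ρ W L) (w : W.E) : ‖D.toLimit.toCLM w‖ ≤ ‖w‖ :=
  le_of_tendsto (D.tendsto_norm w) (.of_forall fun i => D.norm_eval_le i w)

theorem norm_toHom_le (D : UltraLimit U ρ W L) {g : G} {C : ℝ}
    (hC : ∀ i, ‖(ρ i).toHom g‖ ≤ C) : ‖L.toHom g‖ ≤ C := by
  obtain ⟨i₀⟩ := U.neBot.nonempty
  have hC0 : 0 ≤ C := (norm_nonneg _).trans (hC i₀)
  refine ContinuousLinearMap.opNorm_le_bound _ hC0 fun y => ?_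
  induction y using D.denseRange.induction_on with
  | hp => exact isClosed_le (by fun_prop) (by fun_prop)
  | ih w =>
    rw [← D.toLimit.map_toHom]
    refine le_of_tendsto_of_tendsto' (D.tendsto_norm _) ((D.tendsto_norm w).const_mul C)
      fun i => ?_
    rw [(D.eval i).map_toHom]
    exact ContinuousLinearMap.le_of_opNorm_le _ (hC i) _

theorem toLimit_eq_zero (D : UltraLimit U ρ W L) {w : W.E}
    (hw : ∀ᶠ i in U, (D.eval i).toCLM w = 0) : D.toLimit.toCLM w = 0 :=
  norm_eq_zero.1 <| tendsto_nhds_unique (D.tendsto_norm w) <| tendsto_const_nhds.congr' <|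
    hw.mono fun _ hi => (norm_eq_zero.2 hi).symm

theorem toHom_eq_one (D : UltraLimit U ρ W L) {g : G} (hg : ∀ᶠ i in U, (ρ i).toHom g = 1) :
    L.toHom g = 1 := by
  ext y
  induction y using D.denseRange.induction_on with
  | hp => exact isClosed_eq (by fun_prop) (by fun_prop)
  | ih w =>
    have h := D.toLimit_eq_zero (w := W.toHom g w - w) <| hg.mono fun i hi => by
      rw [map_sub, (D.eval i).map_toHom, hi, one_apply_eq_self, sub_self]
    rw [map_sub, D.toLimit.map_toHom] at h
    exact sub_eq_zero.1 h

theorem eventually_abs_norm_sub_le (D : UltraLimit U ρ W L) {A : Set W.E} (hA : IsCompact A)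
    {η : ℝ} (hη : 0 < η) :
    ∀ᶠ i in U, ∀ w ∈ A, |‖(D.eval i).toCLM w‖ - ‖D.toLimit.toCLM w‖| ≤ η := by
  refine hA.induction_on (.of_forall fun _ _ => False.elim)
    (fun s t hst ht => ht.mono fun i hi w hw => hi w (hst hw))
    (fun s t hs ht => (hs.and ht).mono fun i hi w hw => hw.elim (hi.1 w) (hi.2 w)) fun v _ => ?_
  refine ⟨_, mem_nhdsWithin_of_mem_nhds (Metric.ball_mem_nhds v (by positivity : 0 < η / 3)), ?_⟩
  filter_upwards [Metric.tendsto_nhds.1 (D.tendsto_norm v) (η / 3) (by positivity)] with i hi w hw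
  have h_eval := D.norm_eval_le i (w - v)
  have h_limit := D.norm_toLimit_le (w - v)
  rw [map_sub] at h_eval h_limit
  replace h_eval := (abs_norm_sub_norm_le _ _).trans h_eval
  replace h_limit := (abs_norm_sub_norm_le _ _).trans h_limit
  rw [mem_ball_iff_norm] at hw
  rw [Real.dist_eq] at hi
  rw [abs_le] at h_eval h_limit ⊢
  rw [abs_lt] at hi
  constructor <;> linarith

end UltraLimit

variable [IsTopologicalGroup G] [LocallyCompactSpace G]

/-- The families of functions over which the supremum in the definition of `BddRep.basicNhd` is
taken. -/
def testFamilies (Q : Set G) (n : ℕ) : Set (Fin n → C_c(G, ℂ)) :=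
  {f | ∀ k, tsupport (f k) ⊆ Q ∧ l1Norm (f k) ≤ 1}

theorem BanachRep.exists_isCompact_sum_op_mem (ρ : BanachRep G) {n : ℕ} (v : Fin n → ρ.E)
    {Q : Set G} (hQ : IsCompact Q) :
    ∃ A, IsCompact A ∧ ∀ f ∈ testFamilies Q n, ∑ k, ρ.op (f k) (v k) ∈ A := by
  choose K hK hKf using fun k => exists_isCompact_haarAverage_mem (ρ.continuous_orbit (v k)) hQ
  exact ⟨_, (isCompact_univ_pi hK).image (f := fun y : Fin n → ρ.E => ∑ k, y k) (by fun_prop),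
    fun f hf => ⟨fun k => ρ.op (f k) (v k), fun k _ => hKf k (f k) (hf k).1 (hf k).2, rfl⟩⟩

theorem BanachRep.norm_sum_op_le (ρ : BanachRep G) {n : ℕ} {Q : Set G} {C : ℝ} (hC0 : 0 ≤ C)
    (hC : ∀ g ∈ Q, ‖ρ.toHom g‖ ≤ C) {f : Fin n → C_c(G, ℂ)} (hf : f ∈ testFamilies Q n)
    {y : Fin n → ρ.E} {r : ℝ} (hy : ∀ k, ‖y k‖ ≤ r) : ‖∑ k, ρ.op (f k) (y k)‖ ≤ n * (C * r) := by
  have h_op : ∀ k, ‖ρ.op (f k) (y k)‖ ≤ C * r := fun k => by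
    have h0 : 0 ≤ C * r := mul_nonneg hC0 ((norm_nonneg _).trans (hy k))
    exact (norm_haarAverage_le (f k) fun g hg => ContinuousLinearMap.le_of_opNorm_le_of_le _
      (hC g ((hf k).1 hg)) (hy k)).trans (mul_le_of_le_one_left h0 (hf k).2)
  simpa using norm_sum_le_of_le Finset.univ fun k _ => h_op k

theorem BddRep.exists_norm_sum_op_sub_le [T2Space G] {S : Set G} (hS : IsSymmCompactGenSet S)
    {M : ℝ} (L : BddRep S M) {α : Type*} {u : α → L.1.E} (hu : DenseRange u) {n : ℕ}
    (x : Fin n → L.1.E) {Q : Set G} (hQ : IsCompact Q) {η : ℝ} (hη : 0 < η) :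
    ∃ v : Fin n → α, ∀ f ∈ testFamilies Q n,
      ‖∑ k, L.1.op (f k) (u (v k)) - ∑ k, L.1.op (f k) (x k)‖ ≤ η := by
  obtain ⟨C, hC⟩ := exists_norm_toHom_le hS M hQ
  have hr : 0 < η / (n * |C| + 1) := by positivity
  choose v hv using fun k => hu.exists_dist_lt (x k) hr
  refine ⟨v, fun f hf => ?_⟩
  rw [← Finset.sum_sub_distrib]
  simp only [← map_sub]
  refine (L.1.norm_sum_op_le (abs_nonneg C) (fun g hg => (hC L g hg).trans (le_abs_self C)) hf
    (r := η / (n * |C| + 1)) fun k => ?_).trans ?_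
  · rw [← dist_eq_norm']
    exact (hv k).le
  · rw [← mul_assoc, ← mul_div_assoc, div_le_iff₀ (by positivity)]
    nlinarith

theorem UltraLimit.tendsto [T2Space G] {S : Set G} (hS : IsSymmCompactGenSet S) {M : ℝ}
    {U : Ultrafilter ι} {ρ : ι → BddRep S M} {W : BanachRep G} {L : BddRep S M}
    (D : UltraLimit U (fun i => (ρ i).1) W L.1) : Filter.Tendsto ρ U (𝓝 L) := by
  rw [TopologicalSpace.tendsto_nhds_generateFrom_iff]
  rintro _ ⟨ρ₀, n, x, Q, ε, hQ, -, rfl⟩ ⟨x', δ, hδ, hx'⟩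
  have hη : 0 < (ε - δ) / 3 := by linarith
  obtain ⟨v, hv⟩ := L.exists_norm_sum_op_sub_le hS D.denseRange x' hQ hη
  obtain ⟨A, hA, hvA⟩ := W.exists_isCompact_sum_op_mem v hQ
  filter_upwards [D.eventually_abs_norm_sub_le hA hη] with i hi
  refine ⟨fun k => (D.eval i).toCLM (v k), δ + 2 * ((ε - δ) / 3), by linarith, fun f hf => ?_⟩
  have h_eval := hi _ (hvA f hf)
  simp only [map_sum, BanachRep.Hom.map_op] at h_eval
  have h_dense := (abs_norm_sub_norm_le _ _).trans (hv f hf)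
  have h_nhd := hx' f hf
  rw [abs_le] at h_eval h_dense h_nhd ⊢
  constructor <;> linarith

end Closedness

section UniformContraction

variable {G : Type*} [Group G] [TopologicalSpace G] [IsTopologicalGroup G]
  [LocallyCompactSpace G] [T2Space G] {S : Set G} {M : ℝ}

namespace BddRep

theorem exists_continuous_smoothing_family (hS : IsSymmCompactGenSet S) {φ : C_c(G, ℂ)}
    (hφ : haarIntegral φ = 1) {ι : Type} (ρ : ι → BddRep S M) {b : ∀ i, G → (ρ i).1.E}
    (hb : ∀ i, b i ∈ (ρ i).1.Z1) (hb1 : ∀ i, ∀ s ∈ S, ‖b i s‖ ≤ 1) :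
    ∃ x : G → lp (fun i => (ρ i).1.E) ∞, Continuous x ∧
      ∀ g i, x g i = (ρ i).1.smoothing φ (b i) g := by
  have h_mem : ∀ g, Memℓp (fun i => (ρ i).1.smoothing φ (b i) g) ∞ := fun g => by
    obtain ⟨C, hC⟩ := exists_norm_smoothing_le hS M φ (isCompact_singleton (x := g))
    exact memℓp_infty ⟨C, Set.forall_mem_range.2 fun i => hC (ρ i) (b i) (hb i) (hb1 i) g rfl⟩
  refine ⟨fun g => ⟨_, h_mem g⟩, continuous_iff_continuousAt.2 fun g₀ => ?_, fun g i => rfl⟩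
  refine Metric.continuousAt_iff'.2 fun ε hε => ?_
  filter_upwards [eventually_norm_haarAverage_cocycle_sub_le hS M φ g₀ (half_pos hε)] with g hg
  rw [dist_eq_norm]
  refine (lp.norm_le_of_forall_le (half_pos hε).le fun i => ?_).trans_lt (half_lt_self hε)
  change ‖(ρ i).1.smoothing φ (b i) g - (ρ i).1.smoothing φ (b i) g₀‖ ≤ ε / 2
  rw [(ρ i).1.smoothing_sub_smoothing hφ (hb i)]
  exact hg (ρ i) (b i) (hb i) (hb1 i)

theorem eventually_norm_smoothing_le (hS : IsSymmCompactGenSet S) {N : Subgroup G} [N.Normal]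
    {F : Set (BddRep S M)} (hF : IsClosed F) {f : C_c(G, ℂ)} {f' : C_c(G ⧸ N, ℂ)}
    (hff' : ∀ (E : Type) [NormedAddCommGroup E] [NormedSpace ℂ E] [CompleteSpace E]
      (ψ : G ⧸ N → E), Continuous ψ → haarAverage f (fun g => ψ g) = haarAverage f' ψ)
    {κ : ℝ} (hf' : ∀ σ ∈ factoring F N, ∀ β ∈ σ.Z1,
      σ.Contracts (QuotientGroup.mk' N '' S) f' κ β)
    {ι : Type} {U : Ultrafilter ι} {ρ : ι → BddRep S M} (hρ : ∀ i, ρ i ∈ F)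
    {x : G → lp (fun i => (ρ i).1.E) ∞} (hx : Continuous x)
    (hx' : ∀ i, (fun g => x g i) ∈ (ρ i).1.Z1)
    (hρN : ∀ n ∈ N, ∀ᶠ i in U, (ρ i).1.toHom n = 1) (hxN : ∀ n ∈ N, ∀ᶠ i in U, x n i = 0)
    {C : ℝ} (hC : ∀ i, ∀ s ∈ S, ‖x s i‖ ≤ C) {η : ℝ} (hη : 0 < η) :
    ∀ᶠ i in U, ∀ s ∈ S, ‖(ρ i).1.smoothing f (fun g => x g i) s‖ ≤ κ * C + η := by
  obtain ⟨W, L, D, w, hw, hwx⟩ := exists_ultraLimit hS U ρ hx hx'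
  have hLN : ∀ n ∈ N, L.toHom n = 1 := fun n hn => D.toHom_eq_one (hρN n hn)
  have hwN : ∀ n ∈ N, D.toLimit.toCLM (w n) = 0 := fun n hn =>
    D.toLimit_eq_zero ((hxN n hn).mono fun i hi => (hwx i n).trans hi)
  let L' : BddRep S M := ⟨L, fun g hg => D.norm_toHom_le fun i => (ρ i).2 g hg⟩
  have hσ : L.descend N hLN ∈ factoring F N :=
    ⟨L'.2, hF.mem_of_tendsto (UltraLimit.tendsto hS (L := L') D) (.of_forall hρ)⟩
  obtain ⟨β, hβ, hβw⟩ := L.exists_descend_cocycle N hLN (D.toLimit.map_mem_Z1 hw) hwN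
  have hβC : ∀ t ∈ QuotientGroup.mk' N '' S, ‖β t‖ ≤ C := by
    rintro _ ⟨s, hs, rfl⟩
    refine (congrArg norm (hβw s)).trans_le ?_
    exact le_of_tendsto' (D.tendsto_norm _) fun i => (congrArg norm (hwx i s)).trans_le (hC i s hs)
  have h_limit : ∀ s ∈ S, ‖D.toLimit.toCLM (W.smoothing f w s)‖ ≤ κ * C := fun s hs => by
    have h_avg : haarAverage f (fun g => D.toLimit.toCLM (w g)) = haarAverage f' β := by
      simpa only [hβw] using hff' L.E β hβ.1
    rw [D.toLimit.map_smoothing f hw.1, BanachRep.smoothing_apply, h_avg, ← hβw]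
    exact hf' _ hσ β hβ C hβC s ⟨s, hs, rfl⟩
  have h_compact := hS.isCompact.image (W.smoothing_mem_Z1 f hw).1
  filter_upwards [D.eventually_abs_norm_sub_le h_compact hη] with i hi s hs
  have h_eval := hi _ ⟨s, hs, rfl⟩
  rw [(D.eval i).map_smoothing f hw.1, funext (hwx i)] at h_eval
  linarith [(abs_le.1 h_eval).2, h_limit s hs]

theorem exists_contracts_convolve (hS : IsSymmCompactGenSet S) {N : Subgroup G} [N.Normal]
    {F : Set (BddRep S M)} (hF : IsClosed F) {f : C_c(G, ℂ)} (hf : haarIntegral f = 1)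
    {f' : C_c(G ⧸ N, ℂ)}
    (hff' : ∀ (E : Type) [NormedAddCommGroup E] [NormedSpace ℂ E] [CompleteSpace E]
      (ψ : G ⧸ N → E), Continuous ψ → haarAverage f (fun g => ψ g) = haarAverage f' ψ)
    {κ : ℝ} (hf' : ∀ σ ∈ factoring F N, ∀ β ∈ σ.Z1,
      σ.Contracts (QuotientGroup.mk' N '' S) f' κ β)
    {φ : C_c(G, ℂ)} (hφ : haarIntegral φ = 1) {C : ℝ}
    (hC : ∀ ρ : BddRep S M, ∀ b ∈ ρ.1.Z1, (∀ s ∈ S, ‖b s‖ ≤ 1) →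
      ∀ s ∈ S, ‖ρ.1.smoothing φ b s‖ ≤ C)
    {ι : Type} {l : Filter ι} [l.NeBot] {A : ι → Subgroup G}
    (hA : ∀ n ∈ N, ∀ᶠ i in l, n ∈ A i) {η : ℝ} (hη : 0 < η) :
    ∃ i, ∀ ρ ∈ F, (∀ n ∈ A i, ρ.1.toHom n = 1) → ∀ b ∈ ρ.1.Z1, (∀ n ∈ A i, b n = 0) →
      ρ.1.Contracts S (convolve f φ) (κ * C + η) b := by
  by_contra! h_bad
  have h_normalized : ∀ i, ∃ ρ ∈ F, (∀ n ∈ A i, ρ.1.toHom n = 1) ∧ ∃ b ∈ ρ.1.Z1,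
      (∀ n ∈ A i, b n = 0) ∧ (∀ s ∈ S, ‖b s‖ ≤ 1) ∧
        ¬∀ s ∈ S, ‖ρ.1.smoothing (convolve f φ) b s‖ ≤ κ * C + η := fun i => by
    obtain ⟨ρ, hρ, hρA, b, hb, hbA, h_not⟩ := h_bad i
    refine ⟨ρ, hρ, hρA, ?_⟩
    contrapose! h_not
    exact ρ.contracts_of_normalized hS hb fun c hc => h_not (c • b) (ρ.1.Z1.smul_mem c hb)
      (fun n hn => by rw [Pi.smul_apply, hbA n hn, smul_zero]) hc
  choose ρ hρ hρA b hb hbA hb1 h_not using h_normalized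
  obtain ⟨x, hx, hxb⟩ := exists_continuous_smoothing_family hS hφ ρ hb hb1
  have hx' : ∀ i, (fun g => x g i) = (ρ i).1.smoothing φ (b i) := fun i => funext (hxb · i)
  have hAU : ∀ n ∈ N, ∀ᶠ i in Ultrafilter.of l, n ∈ A i := fun n hn =>
    (hA n hn).filter_mono (Ultrafilter.of_le l)
  have hxA : ∀ i, ∀ n ∈ A i, x n i = 0 := fun i n hn => by
    rw [hxb, BanachRep.smoothing_apply, hbA i n hn, hρA i n hn, one_apply_eq_self, sub_self,
      sub_zero]
  obtain ⟨i, hi⟩ := (eventually_norm_smoothing_le hS hF hff' hf' hρ hx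
    (fun i => hx' i ▸ (ρ i).1.smoothing_mem_Z1 φ (hb i))
    (fun n hn => (hAU n hn).mono fun i => hρA i n) (fun n hn => (hAU n hn).mono fun i => hxA i n)
    (fun i s hs => hxb s i ▸ hC (ρ i) (b i) (hb i) (hb1 i) s hs) hη).exists
  refine h_not i fun s hs => ?_
  rw [BanachRep.smoothing_convolve _ hf hφ (hb i), ← hx' i]
  exact hi s hs

end BddRep

theorem HasKazhdanProjection.exists_contracts_of_eventually_mem (hS : IsSymmCompactGenSet S)
    {N : Subgroup G} [N.Normal] (hN : IsClosed (N : Set G)) {F : Set (BddRep S M)}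
    (hF : IsClosed F) (hK : HasKazhdanProjection (BddRep.factoring F N))
    (hH1 : ∀ σ ∈ BddRep.factoring F N, Subsingleton σ.H1) {ι : Type} {l : Filter ι} [l.NeBot]
    {A : ι → Subgroup G} (hA : ∀ n ∈ N, ∀ᶠ i in l, n ∈ A i) {κ : ℝ} (hκ : 0 < κ) :
    ∃ ψ : C_c(G, ℂ), haarIntegral ψ = 1 ∧ ∃ i, ∀ ρ ∈ F, (∀ n ∈ A i, ρ.1.toHom n = 1) →
      ∀ b ∈ ρ.1.Z1, (∀ n ∈ A i, b n = 0) → ρ.1.Contracts S ψ κ b := by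
  obtain ⟨φ, hφ⟩ := exists_haarIntegral_eq_one (G := G)
  obtain ⟨C, hC⟩ := BddRep.exists_norm_smoothing_le hS M φ hS.isCompact
  let κ' : ℝ := κ / (|C| + 1)
  have hκ' : 0 < κ' := by positivity
  obtain ⟨f', hf', hf'_contr⟩ := hK.exists_contracts (hS.image_mk N) (M := M)
    (by rintro σ ⟨h, -⟩ _ ⟨s, hs, rfl⟩; exact h s hs) hH1 hκ'
  obtain ⟨f, hff'⟩ := exists_haarAverage_lift N hN f'
  have hf : haarIntegral f = 1 := by
    rw [← haarAverage_one, hff' ℂ (fun _ => 1) continuous_const, haarAverage_one, hf']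
  obtain ⟨i, hi⟩ := BddRep.exists_contracts_convolve hS hF hf hff' hf'_contr hφ
    (fun ρ b hb hb1 s hs => (hC ρ b hb hb1 s hs).trans (le_abs_self C)) hA hκ'
  have hκ_eq : κ' * |C| + κ' = κ := by
    rw [← mul_add_one, div_mul_cancel₀ _ (by positivity)]
  exact ⟨convolve f φ, by rw [haarIntegral_convolve, hf, hφ, mul_one], i, hκ_eq ▸ hi⟩

end UniformContraction

/-! ### Contraction gives a Kazhdan projection -/

section ContractionKazhdan

variable {G : Type*} [Group G] [TopologicalSpace G] [IsTopologicalGroup G] [LocallyCompactSpace G]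

theorem BanachRep.op_eq_self_of_mem_invariants (ρ : BanachRep G) {f : C_c(G, ℂ)}
    (hf : haarIntegral f = 1) {x : ρ.E} (hx : x ∈ ρ.invariants) : ρ.op f x = x := by
  rw [ρ.op_eq_haarAverage, funext hx, haarAverage_const, hf, one_smul]

theorem BanachRep.exists_projection_of_tendsto (ρ : BanachRep G) {f : ℕ → C_c(G, ℂ)}
    (hf : ∀ n, haarIntegral (f n) = 1) {ε : ℕ → ℝ} (hε₀ : ∀ n, 0 ≤ ε n)
    (hε : Filter.Tendsto ε .atTop (𝓝 0))
    (h : ∀ x, ∃ z ∈ ρ.invariants, ∀ n, ‖ρ.op (f n) x - z‖ ≤ ε n * ‖x‖) :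
    ∃ P : ρ.E →L[ℂ] ρ.E, IsIdempotentElem P ∧ P.range = ρ.invariants ∧
      ∀ n, ‖P - ρ.op (f n)‖ ≤ ε n := by
  choose z hz_inv hz using h
  have hz_lim : ∀ x, Filter.Tendsto (fun n => ρ.op (f n) x) .atTop (𝓝 (z x)) := fun x =>
    tendsto_iff_norm_sub_tendsto_zero.2 <|
      squeeze_zero (fun _ => norm_nonneg _) (hz x) (zero_mul ‖x‖ ▸ hε.mul_const ‖x‖)
  have hz_fix : ∀ x ∈ ρ.invariants, z x = x := fun x hx =>
    tendsto_nhds_unique (hz_lim x) (tendsto_const_nhds.congr fun n =>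
      (ρ.op_eq_self_of_mem_invariants (hf n) hx).symm)
  let P : ρ.E →L[ℂ] ρ.E := continuousLinearMapOfTendsto _ (tendsto_pi_nhds.2 hz_lim)
  refine ⟨P, ContinuousLinearMap.ext fun x => hz_fix _ (hz_inv x), ?_, fun n => ?_⟩
  · ext x
    exact ⟨fun ⟨y, hy⟩ => hy ▸ hz_inv y, fun hx => ⟨x, hz_fix x hx⟩⟩
  · exact ContinuousLinearMap.opNorm_le_bound _ (hε₀ n) fun x =>
      (norm_sub_rev _ _).trans_le (hz x n)

theorem HasKazhdanProjection.of_tendsto {F : Set (BanachRep G)} {f : ℕ → C_c(G, ℂ)}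
    (hf : ∀ n, haarIntegral (f n) = 1) {ε : ℕ → ℝ} (hε₀ : ∀ n, 0 ≤ ε n)
    (hε : Filter.Tendsto ε .atTop (𝓝 0))
    (h : ∀ ρ ∈ F, ∀ x, ∃ z ∈ ρ.invariants, ∀ n, ‖ρ.op (f n) x - z‖ ≤ ε n * ‖x‖) :
    HasKazhdanProjection F := by
  choose p hp_idem hp_range hp using
    fun ρ : F => ρ.1.exists_projection_of_tendsto hf hε₀ hε (h ρ.1 ρ.2)
  have hp_mem : p ∈ closureInCF F {f | haarIntegral (fun g => f g) = 1} := fun δ hδ => by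
    have hlim := ENNReal.tendsto_ofReal hε
    rw [ENNReal.ofReal_zero] at hlim
    obtain ⟨n, hn⟩ := (hlim.eventually_lt_const hδ).exists
    refine ⟨f n, hf n, (iSup_le fun ρ => ?_).trans_lt hn⟩
    exact (ofReal_norm (p ρ - ρ.1.op (f n))).symm.trans_le (ENNReal.ofReal_le_ofReal (hp ρ n))
  exact ⟨p, fun δ hδ => (hp_mem δ hδ).imp fun _ hk => ⟨trivial, hk.2⟩, funext hp_idem, hp_mem,
    fun ρ => ⟨hp_idem ρ, hp_range ρ⟩⟩

/-- The convolution powers of `f`, the `n`-th one being the product of `n + 1` factors. -/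
noncomputable def convPow (f : C_c(G, ℂ)) : ℕ → C_c(G, ℂ)
  | 0 => f
  | n + 1 => convolve f (convPow f n)

theorem haarIntegral_convPow {f : C_c(G, ℂ)} (hf : haarIntegral f = 1) (n : ℕ) :
    haarIntegral (convPow f n) = 1 := by
  induction n with
  | zero => exact hf
  | succ n ih => rw [convPow, haarIntegral_convolve, hf, ih, mul_one]

theorem BanachRep.contracts_convPow {ρ : BanachRep G} {S : Set G} {f : C_c(G, ℂ)}
    (hf : haarIntegral f = 1) {κ : ℝ} (h : ∀ b ∈ ρ.Z1, ρ.Contracts S f κ b) (n : ℕ) {b : G → ρ.E}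
    (hb : b ∈ ρ.Z1) : ρ.Contracts S (convPow f n) (κ ^ (n + 1)) b := by
  induction n with
  | zero => simpa only [convPow, zero_add, pow_one] using h b hb
  | succ n ih =>
    intro D hD
    rw [convPow, ρ.smoothing_convolve hf (haarIntegral_convPow hf n) hb, pow_succ', mul_assoc]
    exact h _ (ρ.smoothing_mem_Z1 _ hb) _ (ih D hD)

variable {S : Set G}

theorem BddRep.eq_coboundary_of_tendsto (hS : IsSymmCompactGenSet S) {M : ℝ} (ρ : BddRep S M)
    {b : G → ρ.1.E} (hb : b ∈ ρ.1.Z1) {f : ℕ → C_c(G, ℂ)} {ε : ℕ → ℝ}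
    (hε : Filter.Tendsto ε .atTop (𝓝 0)) (h : ∀ n, ∀ s ∈ S, ‖ρ.1.smoothing (f n) b s‖ ≤ ε n)
    {y : ρ.1.E} (hy : Filter.Tendsto (fun n => haarAverage (f n) b) .atTop (𝓝 y)) :
    b = ρ.1.coboundary y := by
  refine sub_eq_zero.1 <| ρ.cocycle_eq_zero hS (ρ.1.Z1.sub_mem hb (ρ.1.coboundary_mem_Z1 y))
    fun s hs => ?_
  have hlim : Filter.Tendsto (fun n => ρ.1.smoothing (f n) b s) .atTop
      (𝓝 (b s - ρ.1.coboundary y s)) :=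
    (hy.sub (((ρ.1.toHom s).continuous.tendsto y).comp hy)).const_sub (b s)
  exact le_of_tendsto_of_tendsto' hlim.norm hε fun n => h n s hs

variable [T2Space G]

theorem BddRep.exists_eq_coboundary_of_contracts (hS : IsSymmCompactGenSet S) (M : ℝ)
    {f : C_c(G, ℂ)} (hf : haarIntegral f = 1) {κ : ℝ} (hκ₀ : 0 ≤ κ) (hκ₁ : κ < 1) :
    ∃ A : ℝ, ∀ ρ : BddRep S M, (∀ b ∈ ρ.1.Z1, ρ.1.Contracts S f κ b) →
      ∀ b ∈ ρ.1.Z1, ∀ D : ℝ, (∀ s ∈ S, ‖b s‖ ≤ D) → ∃ y, b = ρ.1.coboundary y ∧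
        ∀ n, ‖haarAverage (convPow f n) b - y‖ ≤ A * D * κ ^ n := by
  obtain ⟨C, -, hC⟩ := exists_norm_cocycle_le hS M f.hasCompactSupport.isCompact
  refine ⟨l1Norm f * C * κ / (1 - κ), fun ρ h b hb D hD => ?_⟩
  have h_smooth : ∀ n, ∀ s ∈ S, ‖ρ.1.smoothing (convPow f n) b s‖ ≤ κ ^ (n + 1) * D := fun n =>
    BanachRep.contracts_convPow hf h n hb D hD
  have h_dist : ∀ n, dist (haarAverage (convPow f n) b) (haarAverage (convPow f (n + 1)) b) ≤
      l1Norm f * C * κ * D * κ ^ n := fun n => by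
    rw [dist_comm, dist_eq_norm, convPow,
      ρ.1.haarAverage_convolve_cocycle hf (haarIntegral_convPow hf n) hb, add_sub_cancel_left]
    refine (norm_haarAverage_le f (hC ρ _ (ρ.1.smoothing_mem_Z1 _ hb) _ (h_smooth n))).trans_eq ?_
    ring
  obtain ⟨y, hy⟩ := cauchySeq_tendsto_of_complete (cauchySeq_of_le_geometric κ _ hκ₁ h_dist)
  have h_zero : Filter.Tendsto (fun n : ℕ => κ ^ (n + 1) * D) .atTop (𝓝 0) := by
    simpa only [zero_mul] using ((Filter.tendsto_add_atTop_iff_nat 1).2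
      (tendsto_pow_atTop_nhds_zero_of_lt_one hκ₀ hκ₁)).mul_const D
  refine ⟨y, ρ.eq_coboundary_of_tendsto hS hb h_zero h_smooth hy, fun n => ?_⟩
  rw [← dist_eq_norm]
  refine (dist_le_of_le_geometric_of_tendsto κ _ hκ₁ h_dist hy n).trans_eq ?_
  ring

theorem HasKazhdanProjection.of_contracts (hS : IsSymmCompactGenSet S) {M : ℝ}
    {F : Set (BanachRep G)} (hF : ∀ σ ∈ F, ∀ g ∈ S, ‖σ.toHom g‖ ≤ M) {f : C_c(G, ℂ)}
    (hf : haarIntegral f = 1) {κ : ℝ} (hκ₀ : 0 ≤ κ) (hκ₁ : κ < 1)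
    (h : ∀ σ ∈ F, ∀ β ∈ σ.Z1, σ.Contracts S f κ β) :
    HasKazhdanProjection F ∧ ∀ σ ∈ F, Subsingleton σ.H1 := by
  obtain ⟨A, hA⟩ := BddRep.exists_eq_coboundary_of_contracts hS M hf hκ₀ hκ₁
  constructor
  · refine .of_tendsto (haarIntegral_convPow hf) (ε := fun n => |A| * (1 + |M|) * κ ^ n)
      (fun n => by positivity)
      (by simpa only [mul_zero] using
        (tendsto_pow_atTop_nhds_zero_of_lt_one hκ₀ hκ₁).const_mul (|A| * (1 + |M|)))
      fun σ hσ x => ?_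
    obtain ⟨y, hxy, hy⟩ := hA ⟨σ, hF σ hσ⟩ (h σ hσ) _ (σ.coboundary_mem_Z1 x) _ fun s hs =>
      σ.norm_coboundary_le x ((hF σ hσ s hs).trans (le_abs_self M))
    refine ⟨x - y, fun g => ?_, fun n => ?_⟩
    · have hg : σ.coboundary (x - y) g = 0 := by rw [map_sub, hxy, sub_self, Pi.zero_apply]
      exact (sub_eq_zero.1 hg).symm
    · calc ‖σ.op (convPow f n) x - (x - y)‖ = ‖haarAverage (convPow f n) (σ.coboundary x) - y‖ := by
            rw [σ.haarAverage_coboundary (haarIntegral_convPow hf n), ← norm_neg]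
            congr 1
            abel
        _ ≤ A * ((1 + |M|) * ‖x‖) * κ ^ n := hy n
        _ ≤ |A| * ((1 + |M|) * ‖x‖) * κ ^ n := by gcongr; exact le_abs_self A
        _ = |A| * (1 + |M|) * κ ^ n * ‖x‖ := by ring
  · refine fun σ hσ => BanachRep.subsingleton_H1_iff.2 fun β hβ => ?_
    obtain ⟨D, hD⟩ := hS.isCompact.exists_bound_of_continuousOn hβ.1.continuousOn
    exact (hA ⟨σ, hF σ hσ⟩ (h σ hσ) β hβ D hD).imp fun _ hy => hy.1

theorem HasKazhdanProjection.factoring_of_contracts (hS : IsSymmCompactGenSet S) {M : ℝ}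
    (N : Subgroup G) [N.Normal] (hN : IsClosed (N : Set G)) {F : Set (BddRep S M)}
    {ψ : C_c(G, ℂ)} (hψ : haarIntegral ψ = 1) {κ : ℝ} (hκ₀ : 0 ≤ κ) (hκ₁ : κ < 1)
    (h : ∀ ρ ∈ F, (∀ n ∈ N, ρ.1.toHom n = 1) →
      ∀ b ∈ ρ.1.Z1, (∀ n ∈ N, b n = 0) → ρ.1.Contracts S ψ κ b) :
    HasKazhdanProjection (BddRep.factoring F N) ∧
      ∀ σ ∈ BddRep.factoring F N, Subsingleton σ.H1 := by
  obtain ⟨k, hk⟩ := exists_haarAverage_quotient N hN ψ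
  have hk_one : haarIntegral k = 1 := by
    rw [← haarAverage_one, hk ℂ (fun _ => 1) continuous_const, haarAverage_one, hψ]
  have hN_one : ∀ n ∈ N, (n : G ⧸ N) = 1 := fun n hn => (QuotientGroup.eq_one_iff n).2 hn
  refine HasKazhdanProjection.of_contracts (hS.image_mk N)
    (by rintro σ ⟨hσ, -⟩ _ ⟨s, hs, rfl⟩; exact hσ s hs) hk_one hκ₀ hκ₁ ?_
  rintro σ ⟨hσ, hσF⟩ β hβ D hD _ ⟨s, hs, rfl⟩
  rw [BanachRep.smoothing_apply, hk σ.E β hβ.1]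
  refine h ⟨σ.pullback N, hσ⟩ hσF (fun n hn => ?_) (fun g => β g) (BanachRep.pullback_mem_Z1 hβ)
    (fun n hn => ?_) D (fun s hs => hD _ ⟨s, hs, rfl⟩) s hs
  · exact (congrArg σ.toHom (hN_one n hn)).trans (map_one σ.toHom)
  · exact (congrArg β (hN_one n hn)).trans (BanachRep.cocycle_one hβ)

end ContractionKazhdan

/-! ### Compact presentations of quotients -/

section CompactPresentation

open scoped Pointwise

variable {G : Type*} [Group G] [TopologicalSpace G]

theorem IsSymmCompactGenSet.of_closure_eq_top [IsTopologicalGroup G] {T : Set G}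
    (hT : IsCompact T) (hT_gen : Subgroup.closure T = ⊤) :
    IsSymmCompactGenSet (insert 1 (T ∪ T⁻¹)) where
  isCompact := (hT.union hT.inv).insert 1
  inv_mem := by
    rintro g (rfl | hg | hg)
    · exact Or.inl inv_one
    · exact Or.inr (Or.inr (Set.inv_mem_inv.2 hg))
    · exact Or.inr (Or.inl hg)
  one_mem := Set.mem_insert 1 _
  closure_eq_top :=
    top_le_iff.1 <| hT_gen ▸ Subgroup.closure_mono fun _ hg => Or.inr (Or.inl hg)

theorem exists_word_of_mem_pow {G : Type*} [Group G] {T : Set G} (m : ℕ) :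
    ∀ g ∈ (insert 1 (T ∪ T⁻¹)) ^ m, ∃ w : List (T × Bool), w.length ≤ m ∧
        FreeGroup.lift (fun t : T => (t : G)) (FreeGroup.mk w) = g := by
  induction m with
  | zero => exact fun g hg => ⟨[], le_rfl, (map_one _).trans hg.symm⟩
  | succ m ih =>
    rw [pow_succ]
    rintro _ ⟨g, hg, s, hs, rfl⟩
    obtain ⟨w, hw, rfl⟩ := ih g hg
    obtain ⟨v, hv, rfl⟩ : ∃ v : List (T × Bool), v.length ≤ 1 ∧
        FreeGroup.lift (fun t : T => (t : G)) (FreeGroup.mk v) = s := by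
      rcases hs with rfl | hs | hs
      · exact ⟨[], zero_le_one, map_one _⟩
      · exact ⟨[(⟨s, hs⟩, true)], le_rfl, by simp⟩
      · exact ⟨[(⟨s⁻¹, hs⟩, false)], le_rfl, by simp⟩
    refine ⟨w ++ v, ?_, ?_⟩
    · rw [List.length_append]
      exact add_le_add hw hv
    · rw [← FreeGroup.mul_mk, map_mul]

theorem ker_lift_image_mk {G : Type*} [Group G] (N : Subgroup G) [N.Normal] (T : Set G) :
    (FreeGroup.lift fun t : QuotientGroup.mk' N '' T => (t : G ⧸ N)).ker =
      (N.comap (FreeGroup.lift fun t : T => (t : G))).map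
        (FreeGroup.map (Set.imageFactorization (QuotientGroup.mk' N) T)) := by
  have h_comp : (FreeGroup.lift fun t : QuotientGroup.mk' N '' T => (t : G ⧸ N)).comp
      (FreeGroup.map (Set.imageFactorization (QuotientGroup.mk' N) T)) =
      (QuotientGroup.mk' N).comp (FreeGroup.lift fun t : T => (t : G)) := by
    ext t
    simp only [MonoidHom.comp_apply, FreeGroup.map.of, FreeGroup.lift_apply_of,
      Set.imageFactorization]
  have h_comap : N.comap (FreeGroup.lift fun t : T => (t : G)) =
      (FreeGroup.lift fun t : QuotientGroup.mk' N '' T => (t : G ⧸ N)).ker.comap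
        (FreeGroup.map (Set.imageFactorization (QuotientGroup.mk' N) T)) := by
    rw [MonoidHom.comap_ker, h_comp, ← MonoidHom.comap_ker, QuotientGroup.ker_mk']
  rw [h_comap, Subgroup.map_comap_eq_self_of_surjective
    (FreeGroup.map_surjective Set.imageFactorization_surjective)]

theorem IsCompactlyPresented.quotient_normalClosure [IsTopologicalGroup G] [LocallyCompactSpace G]
    [T2Space G] (hG : IsCompactlyPresented G) {A : Set G} (hA : IsCompact A) :
    IsCompactlyPresented (G ⧸ Subgroup.normalClosure A) := by
  obtain ⟨T, hT, hT_gen, n, R, hRn, hR⟩ := hG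
  obtain ⟨k, hk⟩ := (IsSymmCompactGenSet.of_closure_eq_top hT hT_gen).exists_subset_pow hA
  choose! w hw_len hw using fun g (hg : g ∈ A) => exists_word_of_mem_pow k g (hk hg)
  let N := Subgroup.normalClosure A
  let q : G →* G ⧸ N := QuotientGroup.mk' N
  let e : T → q '' T := Set.imageFactorization q T
  let π : FreeGroup T →* G := FreeGroup.lift fun t : T => (t : G)
  let W : Set (List (T × Bool)) := R ∪ w '' A
  let toQuot : List (T × Bool) → List (q '' T × Bool) := List.map fun p => (e p.1, p.2)
  have hπ : Function.Surjective π := MonoidHom.range_eq_top.1 <| by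
    rw [FreeGroup.range_lift_eq_closure, Subtype.range_coe, hT_gen]
  refine ⟨q '' T, hT.image continuous_quot_mk, ?_, max n k, toQuot '' W, ?_, ?_⟩
  · rw [← MonoidHom.map_closure, hT_gen]
    exact Subgroup.map_top_of_surjective q (QuotientGroup.mk'_surjective N)
  · rintro _ ⟨v, hv | ⟨a, ha, rfl⟩, rfl⟩
    · exact (List.length_map _).trans_le ((hRn v hv).trans (le_max_left n k))
    · exact (List.length_map _).trans_le ((hw_len a ha).trans (le_max_right n k))
  · have h_words : π '' (FreeGroup.mk '' (w '' A)) = A := by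
      rw [Set.image_image, Set.image_image, Set.image_congr hw, Set.image_id']
    have h_normal : Subgroup.normalClosure (FreeGroup.mk '' W) = N.comap π := by
      rw [Set.image_union, Subgroup.normalClosure_union, ← hR, sup_comm, ← Subgroup.comap_map_eq,
        Subgroup.map_normalClosure _ _ hπ, h_words]
    have h_image : FreeGroup.mk '' (toQuot '' W) = FreeGroup.map e '' (FreeGroup.mk '' W) := by
      rw [Set.image_image, Set.image_image]
      rfl
    rw [h_image, ← Subgroup.map_normalClosure _ _
      (FreeGroup.map_surjective Set.imageFactorization_surjective), h_normal]
    exact ker_lift_image_mk N T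

end CompactPresentation

theorem isClosed_normalClosure_inter {G : Type*} [Group G] [TopologicalSpace G]
    [IsTopologicalGroup G] {N : Subgroup G} [N.Normal] (hN : IsClosed (N : Set G)) {V : Set G}
    (hV : V ∈ 𝓝 1) : IsClosed (Subgroup.normalClosure (N ∩ V) : Set G) := by
  have hle : Subgroup.normalClosure (N ∩ V) ≤ N :=
    Subgroup.normalClosure_le_normal Set.inter_subset_left
  have h_closed : IsClosed ((Subgroup.normalClosure (N ∩ V)).subgroupOf N : Set ↥N) := by
    refine Subgroup.isClosed_of_isOpen _ (Subgroup.isOpen_of_mem_nhds _ (g := 1) ?_)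
    filter_upwards [continuous_subtype_val.continuousAt.preimage_mem_nhds hV] with n hn
    exact Subgroup.subset_normalClosure ⟨n.2, hn⟩
  have h_image := hN.isClosedEmbedding_subtypeVal.isClosedMap _ h_closed
  rwa [← Subgroup.coe_subtype, ← Subgroup.coe_map, Subgroup.map_subgroupOf_eq_of_le hle] at h_image

open scoped Pointwise in
theorem theorem4p12_general {G : Type*} [Group G] [TopologicalSpace G] [IsTopologicalGroup G]
    [LocallyCompactSpace G] [T2Space G] {S : Set G} (hS : IsSymmCompactGenSet S)
    (hG : IsCompactlyPresented G) {M : ℝ} {N : Subgroup G} [N.Normal]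
    (hN : IsClosed (N : Set G)) {F : Set (BddRep S M)} (hF : IsClosed F)
    (hK : HasKazhdanProjection (BddRep.factoring F N))
    (hH1 : ∀ σ ∈ BddRep.factoring F N, Subsingleton σ.H1) :
    ∃ (N' : Subgroup G) (_ : N'.Normal), IsClosed (N' : Set G) ∧ N' ≤ N ∧
      IsCompactlyPresented (G ⧸ N') ∧
      HasKazhdanProjection (BddRep.factoring F N') ∧
      ∀ σ ∈ BddRep.factoring F N', Subsingleton σ.H1 := by
  obtain ⟨V, hV, hV_one⟩ := exists_compact_mem_nhds (1 : G)
  obtain ⟨m₀, hm₀⟩ := hS.exists_subset_pow hV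
  let A : ℕ → Subgroup G := fun m => Subgroup.normalClosure (N ∩ S ^ (m₀ + m))
  have hA : ∀ n ∈ N, ∀ᶠ m in Filter.atTop, n ∈ A m := fun n hn => by
    obtain ⟨k, hk⟩ := hS.exists_mem_pow n
    filter_upwards [Filter.eventually_ge_atTop k] with m hm
    exact Subgroup.subset_normalClosure ⟨hn, hS.pow_mono (hm.trans (Nat.le_add_left m m₀)) hk⟩
  obtain ⟨ψ, hψ, m, hm⟩ := hK.exists_contracts_of_eventually_mem hS hN hF hH1 hA one_half_pos
  have hA_closed : IsClosed (A m : Set G) := isClosed_normalClosure_inter hN <|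
    Filter.mem_of_superset hV_one (hm₀.trans (hS.pow_mono (Nat.le_add_right m₀ m)))
  exact ⟨A m, inferInstance, hA_closed, Subgroup.normalClosure_le_normal Set.inter_subset_left,
    hG.quotient_normalClosure ((hS.isCompact_pow _).inter_left hN),
    HasKazhdanProjection.factoring_of_contracts hS (A m) hA_closed hψ one_half_pos.le
      one_half_lt_one hm⟩

theorem theorem4p12 {G : Type*} [Group G] [TopologicalSpace G] [IsTopologicalGroup G]
    [LocallyCompactSpace G] [T2Space G] [TopologicalSpace.SeparableSpace G]
    (S : Set G) (hS : IsCompact S) (hSsymm : ∀ g ∈ S, g⁻¹ ∈ S) (hSone : (1 : G) ∈ S)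
    (hSgen : Subgroup.closure S = ⊤)
    (hG : IsCompactlyPresented G)
    (M : ℝ) (hM : 1 < M)
    (N : Subgroup G) [N.Normal] [DiscreteTopology N]
    (F : Set (BddRep S M)) (hF : IsClosed F)
    (hK : HasKazhdanProjection (BddRep.factoring F N))
    (hH1 : ∀ σ ∈ BddRep.factoring F N, Subsingleton σ.H1) :
    ∃ (N' : Subgroup G) (_ : N'.Normal), N' ≤ N ∧
      IsCompactlyPresented (G ⧸ N') ∧
      HasKazhdanProjection (BddRep.factoring F N') ∧
      ∀ σ ∈ BddRep.factoring F N', Subsingleton σ.H1 := by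
  obtain ⟨N', hN', -, h⟩ := theorem4p12_general ⟨hS, hSsymm, hSone, hSgen⟩ hG
    Subgroup.isClosed_of_discrete hF hK hH1
  exact ⟨N', hN', h⟩
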